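/- **Setting.** An input with $k$ terminals is a directed graph $G$ on the vertex set $\{1,\dots,n\}$ (edges are ordered pairs), two distinct vertices $s,t$, and a labelled set $T=\{q_1,\dots,q_k\}$ of $k$ distinct vertices (the terminals; $s,t$ may or may not be among them). A query is a set $Q$ of ordered pairs of terminals, given by their labels, and $G^Q$ is $G$ with the edges of $Q$ inserted (an edge already present is not duplicated). The $s$-$t$ edge-connectivity $\lambda_{s,t}(G^Q)$ is the least number of edges whose deletion destroys all directed paths from $s$ to $t$. A randomized $k$-dynamic sketching scheme is a pair of (computable) randomized algorithms with independent fair coins: the compression algorithm maps $(G,s,t,T)$ to a sketch $\Gamma$, a list of machine words, and the extraction algorithm maps $(Q,\Gamma)$ to a number, without further access to $G$. The size of a sketch is its number of machine words, each of $O(\log n)$ bits. **Theorem.** (1) There is an absolute constant $C$ such that for all $k\ge 1$ and $\delta>0$ there is a randomized $k$-dynamic sketching scheme for $s$-$t$ edge-connectivity which, on every input and for every query $Q$, outputs $\lambda_{s,t}(G^Q)$ with probability at least $1-\delta$, and all of whose sketches consist of at most $C\,k^4\max\{1,\log(1/\delta)\}$ machine words, each word being a nonnegative integer less than $n^{C}$.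 (2) Connectivity queries reduce to maximum-matching queries on an auxiliary bipartite graph with $4k^2$ terminals: there is an absolute constant $C$ such that for every $k$ there is a map $Q\mapsto Q'$ from queries to sets of edges on $4k^2$ labelled terminals with the following property. For every input $(G,s,t,T)$ there are a graph $G'$ on at most $Cn^2$ vertices with $4k^2$ distinct labelled terminals, a fixed partition of its vertices into two sides, and an integer $m\ge 0$ such that for every query $Q$ all edges of $G'^{Q'}$ ($G'$ with the edges of $Q'$ inserted) join the two sides, and $$\nu(G'^{Q'})=\lambda_{s,t}(G^Q)+m+2k^2-|Q|,$$ where $\nu$ denotes the maximum size of a matching. -/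

import Mathlib

/-- A randomized algorithm from `α` to `β`: on input `a` it tosses `coins a` fair coins and then
computes its output from `a` and the list of outcomes. Both steps are computable functions. -/
structure RandAlg (α β : Type) [Primcodable α] [Primcodable β] where
  coins : α → ℕ
  run : α → List Bool → β
  computable_coins : Computable coins
  computable_run : Computable₂ run

namespace RandAlg

variable {α β : Type} [Primcodable α] [Primcodable β]

/-- The output distribution on input `a`, over independent fair coins. -/
noncomputable def dist (A : RandAlg α β) (a : α) : PMF β :=
  (PMF.uniformOfFintype (Fin (A.coins a) → Bool)).map fun r => A.run a (List.ofFn r)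

end RandAlg

/-- An edge set `F` of the digraph `G` is an `s`-`t` cut if after deleting `F` there is no
directed path from `s` to `t`. -/
def IsSTCut {V : Type} (G : Digraph V) (s t : V) (F : Finset (V × V)) : Prop :=
  (∀ e ∈ F, G.Adj e.1 e.2) ∧
    ¬ Relation.ReflTransGen (fun u v => G.Adj u v ∧ (u, v) ∉ F) s t

/-- The `s`-`t` edge-connectivity: the least number of edges whose deletion destroys all directed
paths from `s` to `t` (used only for `s ≠ t` in finite digraphs, where a cut exists). -/
noncomputable def stEdgeConnectivity {V : Type} (G : Digraph V) (s t : V) : ℕ :=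
  sInf {c | ∃ F : Finset (V × V), IsSTCut G s t F ∧ F.card = c}

/-- The maximum size of a matching (used only for finite graphs, where it is attained). -/
noncomputable def matchingNumber {V : Type} (G : SimpleGraph V) : ℕ :=
  sSup {m | ∃ M : G.Subgraph, M.IsMatching ∧ M.edgeSet.ncard = m}

/-- A query: the Boolean adjacency matrix of a set of ordered pairs of the `k` terminals, which
are referred to by their indices. -/
abbrev Query (k : ℕ) : Type := Fin k → Fin k → Bool

/-- The number of edges in a query. -/
def Query.size {k : ℕ} (Q : Query k) : ℕ :=
  (Finset.univ.filter fun p : Fin k × Fin k => Q p.1 p.2 = true).card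

/-- An input of the `s`-`t` edge-connectivity problem with `k` terminals: a digraph on `n`
vertices, distinct vertices `s` and `t`, and `k` distinct labelled terminals. -/
structure STInstance (k n : ℕ) where
  graph : Digraph (Fin n)
  s : Fin n
  t : Fin n
  s_ne_t : s ≠ t
  terminal : Fin k ↪ Fin n

namespace STInstance

variable {k n : ℕ}

/-- The digraph obtained by inserting all edges of the query. -/
def insertQuery (I : STInstance k n) (Q : Query k) : Digraph (Fin n) where
  Adj u v := I.graph.Adj u v ∨ ∃ i j, Q i j = true ∧ I.terminal i = u ∧ I.terminal j = v

/-- The correct answer to a query. -/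
noncomputable def answer (I : STInstance k n) (Q : Query k) : ℕ :=
  stEdgeConnectivity (I.insertQuery Q) I.s I.t

open Classical in
/-- The input as a finite object: the adjacency matrix, row by row, then `s` and `t`, then the
list of the terminals. -/
noncomputable def encoding (I : STInstance k n) : List (List Bool) × (ℕ × ℕ) × List ℕ :=
  (List.ofFn fun u => List.ofFn fun v => decide (I.graph.Adj u v),
    ((I.s : ℕ), (I.t : ℕ)), List.ofFn fun i => (I.terminal i : ℕ))

end STInstance

/-- A randomized `k`-dynamic sketching scheme for `s`-`t` edge-connectivity. A sketch is a list of
machine words. The extraction algorithm sees only the query and the sketch; its coins are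
independent of those of the compression algorithm. -/
structure STSketchingScheme (k : ℕ) where
  compress : RandAlg (List (List Bool) × (ℕ × ℕ) × List ℕ) (List ℕ)
  extract : RandAlg (Query k × List ℕ) ℕ

namespace STSketchingScheme

variable {k : ℕ}

/-- The distribution of the answer to the query `Q` on the input `I`. -/
noncomputable def output (S : STSketchingScheme k) {n : ℕ} (I : STInstance k n) (Q : Query k) :
    PMF ℕ :=
  (S.compress.dist I.encoding).bind fun Γ => S.extract.dist (Q, Γ)

/-- On every input, every query is answered correctly with probability at least `p`. -/
def CorrectWithProb (S : STSketchingScheme k) (p : ℝ) : Prop :=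
  ∀ (n : ℕ) (I : STInstance k n) (Q : Query k), p ≤ (S.output I Q (I.answer Q)).toReal

/-- On every input with `n` vertices, every sketch that can be produced consists of at most `L`
machine words, each of them a number below `n ^ c`, that is, a word of `c * log n` bits. -/
def SketchSizeAtMost (S : STSketchingScheme k) (c : ℕ) (L : ℝ) : Prop :=
  ∀ (n : ℕ) (I : STInstance k n), ∀ Γ ∈ (S.compress.dist I.encoding).support,
    (Γ.length : ℝ) ≤ L ∧ ∀ w ∈ Γ, w < n ^ c

end STSketchingScheme

/-! Both parts rest on one bipartite graph, the relation `cutRel`. Edge-disjoint paths from s to t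
are vertex-disjoint paths in the line graph, and these become matchings once every vertex of the
line graph is split into a row (its exit) and a column (its entrance): an unused vertex is matched
to itself, and a path is a chain of off-diagonal entries from a source row to a sink column. With
three self-matchable objects per pair of vertices, the maximum matching has size 3n² + λ. A pair
outside G gets two halves: half 1 is always attached to its predecessors and half 2 to its
successors, and inserting the edge only adds the entry from row (1, p) to column (2, p). Hence a
query switches entries at k² fixed positions, in distinct rows and distinct columns. The value 3n² +
λ is obtained without flows: cuts and vertex covers are converted into each other
(`exists_cover_of_isSTCut`, `exists_isSTCut_of_cover`), and König's theorem supplies the matching.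

For matching queries, the rows (1, p) and columns (2, p) are 2k² of the terminals. The other 2k²
carry one isolated edge for each pair that is not queried, which adds k² - |Q| to the matching
number.

For the sketch, random weights modulo a prime p are put on the entries of the relation. The rank is
at most 3n² + λ because of the cover, and equality fails with small probability by Schwartz-Zippel
(`card_rank_lt_le`), so the nullity of this 4n² × 4n² matrix is n² - λ. By
`exists_small_matrix_nullity` the nullities for all queries are determined by a constant and two 2k²
× k² matrices, that is, by 1 + 4k⁴ residues modulo p. Only computability is required, so these
residues are found by exhaustive search and nullities by counting kernel vectors. -/

/-! ### König's theorem -/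

/-- **König's theorem** for a relation between finite types: a vertex cover and a matching of the
same size. -/
theorem exists_cover_matching {α β : Type*} [Fintype α] [Fintype β] (r : α → β → Prop) :
    ∃ (A : Finset α) (B : Finset β), (∀ a b, r a b → a ∈ A ∨ b ∈ B) ∧
      ∃ (f : Fin (A.card + B.card) → α) (g : Fin (A.card + B.card) → β),
        f.Injective ∧ g.Injective ∧ ∀ i, r (f i) (g i) := by
  classical
  obtain ⟨⟨A, B⟩, hc, hmin⟩ : ∃ C : Finset α × Finset β,
      (∀ a b, r a b → a ∈ C.1 ∨ b ∈ C.2) ∧ ∀ C' : Finset α × Finset β,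
        (∀ a b, r a b → a ∈ C'.1 ∨ b ∈ C'.2) → C.1.card + C.2.card ≤ C'.1.card + C'.2.card := by
    have := Finset.exists_min_image
      (Finset.univ.filter fun C : Finset α × Finset β => ∀ a b, r a b → a ∈ C.1 ∨ b ∈ C.2)
      (fun C => C.1.card + C.2.card) ⟨(Finset.univ, Finset.univ), by simp⟩
    simpa using this
  refine ⟨A, B, hc, ?_⟩
  -- Hall's condition for matching `A` into the columns outside `B`: if some `S ⊆ A` had too few
  -- neighbours there, exchanging `S` for these neighbours would give a smaller cover. The matching
  -- of `B` into the rows outside `A` is symmetric, and the two are disjoint.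
  obtain ⟨f₁, hf₁, hf₁'⟩ := (Finset.all_card_le_biUnion_card_iff_exists_injective
      (fun a : A => Finset.univ.filter fun b => r a b ∧ b ∉ B)).1 (by
    intro S
    set T := S.biUnion fun a : A => Finset.univ.filter fun b => r a b ∧ b ∉ B
    have h := hmin (A \ S.map (Function.Embedding.subtype _), B ∪ T) (by
      intro a b hab
      by_cases hb : b ∈ B
      · simp [hb]
      by_cases ha : ∃ h : a ∈ A, (⟨a, h⟩ : A) ∈ S
      · obtain ⟨h, h'⟩ := ha
        right
        simp only [Finset.mem_union, T, Finset.mem_biUnion, Finset.mem_filter, Finset.mem_univ,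
          true_and]
        exact Or.inr ⟨_, h', hab, hb⟩
      · left
        have := (hc a b hab).resolve_right hb
        simp only [Finset.mem_sdiff, this, Finset.mem_map, true_and]
        rintro ⟨⟨x, hx⟩, hxS, rfl⟩
        exact ha ⟨hx, hxS⟩)
    have h1 : (A \ S.map (Function.Embedding.subtype _)).card + S.card = A.card := by
      rw [← Finset.card_map (Function.Embedding.subtype _)]
      refine Finset.card_sdiff_add_card_eq_card ?_
      intro x hx
      simp only [Finset.mem_map] at hx
      obtain ⟨y, -, rfl⟩ := hx
      exact y.2
    have h2 := Finset.card_union_le B T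
    simp only at h
    omega)
  obtain ⟨f₂, hf₂, hf₂'⟩ := (Finset.all_card_le_biUnion_card_iff_exists_injective
      (fun b : B => Finset.univ.filter fun a => r a b ∧ a ∉ A)).1 (by
    intro S
    set T := S.biUnion fun b : B => Finset.univ.filter fun a => r a b ∧ a ∉ A
    have h := hmin (A ∪ T, B \ S.map (Function.Embedding.subtype _)) (by
      intro a b hab
      by_cases ha : a ∈ A
      · simp [ha]
      by_cases hb : ∃ h : b ∈ B, (⟨b, h⟩ : B) ∈ S
      · obtain ⟨h, h'⟩ := hb
        left
        simp only [Finset.mem_union, T, Finset.mem_biUnion, Finset.mem_filter, Finset.mem_univ,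
          true_and]
        exact Or.inr ⟨_, h', hab, ha⟩
      · right
        have := (hc a b hab).resolve_left ha
        simp only [Finset.mem_sdiff, this, Finset.mem_map, true_and]
        rintro ⟨⟨x, hx⟩, hxS, rfl⟩
        exact hb ⟨hx, hxS⟩)
    have h1 : (B \ S.map (Function.Embedding.subtype _)).card + S.card = B.card := by
      rw [← Finset.card_map (Function.Embedding.subtype _)]
      refine Finset.card_sdiff_add_card_eq_card ?_
      intro x hx
      simp only [Finset.mem_map] at hx
      obtain ⟨y, -, rfl⟩ := hx
      exact y.2
    have h2 := Finset.card_union_le A T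
    simp only at h
    omega)
  simp only [Finset.mem_filter, Finset.mem_univ, true_and] at hf₁' hf₂'
  have e : Fin (A.card + B.card) ≃ A ⊕ B := Fintype.equivOfCardEq (by simp)
  refine ⟨Sum.elim (fun a : A => (a : α)) f₂ ∘ e, Sum.elim f₁ (fun b : B => (b : β)) ∘ e,
    ?_, ?_, ?_⟩
  · refine Function.Injective.comp ?_ e.injective
    refine Function.Injective.sumElim Subtype.val_injective hf₂ ?_
    intro a b h
    exact (hf₂' b).2 (h ▸ a.2)
  · refine Function.Injective.comp ?_ e.injective
    refine Function.Injective.sumElim hf₁ Subtype.val_injective ?_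
    intro a b h
    exact (hf₁' a).2 (h ▸ b.2)
  · intro i
    simp only [Function.comp_apply]
    rcases e i with a | b
    · exact (hf₁' a).1
    · exact (hf₂' b).1

/-! ### Edge cuts as vertex covers of a bipartite relation -/

/-- The bipartite relation between rows and columns, both labelled by a kind below `4` and a pair of
vertices, whose maximum matchings encode minimum `s`-`t` cuts of the digraph with edge relation
`A ∨ B`. Kind `0` stands for an edge of `A`, kinds `1` and `2` for the two halves of an edge
of `B` that is not in `A`, kind `3` for the source (rows) and the sink (columns). -/
def cutRel {V : Type*} (A B : V → V → Prop) (s t : V) (c : ℕ) (p : V × V) (c' : ℕ) (p' : V × V) :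
    Prop :=
  (c = c' ∧ c ≠ 3 ∧ p = p') ∨
  ((c' = 0 ∧ A p'.1 p'.2 ∨ c' = 1 ∧ ¬ A p'.1 p'.2) ∧
    ((c = 0 ∨ c = 2) ∧ p.2 = p'.1 ∨ c = 3 ∧ p = p' ∧ p.1 = s)) ∨
  ((c = 0 ∨ c = 2) ∧ c' = 3 ∧ p = p' ∧ p.2 = t) ∨
  (c = 1 ∧ c' = 2 ∧ p = p' ∧ B p.1 p.2)

section CutRel

variable {V : Type} [Fintype V]

theorem card_kind_ne_three : (Finset.univ.filter fun x : Fin 4 × V × V => (x.1 : ℕ) ≠ 3).card =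
    3 * Fintype.card V ^ 2 := by
  classical
  have : (Finset.univ.filter fun x : Fin 4 × V × V => (x.1 : ℕ) ≠ 3) =
      (Finset.univ.filter fun c : Fin 4 => (c : ℕ) ≠ 3) ×ˢ (Finset.univ : Finset (V × V)) := by
    ext x; simp
  rw [this, Finset.card_product]
  have : (Finset.univ.filter fun c : Fin 4 => (c : ℕ) ≠ 3).card = 3 := by decide
  rw [this, Finset.card_univ, Fintype.card_prod, sq]

/-- An object that can be entered from the source side of the cut pays with its column, every other
object of kind below 3 with its row. Only a cut edge pays twice, once it has been entered, since its
row must be blocked as well. -/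
theorem exists_cover_of_isSTCut (A B : V → V → Prop) (s t : V) (F : Finset (V × V))
    (hF : IsSTCut ⟨fun u v => A u v ∨ B u v⟩ s t F) :
    ∃ CR CC : Finset (Fin 4 × V × V),
      (∀ x y, cutRel A B s t x.1 x.2 y.1 y.2 → x ∈ CR ∨ y ∈ CC) ∧
      CR.card + CC.card ≤ 3 * Fintype.card V ^ 2 + F.card := by
  classical
  obtain ⟨hF1, hF2⟩ := hF
  set S : V → Prop := Relation.ReflTransGen (fun u v => (A u v ∨ B u v) ∧ (u, v) ∉ F) s with hS
  have hs : S s := Relation.ReflTransGen.refl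
  have hstep : ∀ u v, S u → (A u v ∨ B u v) → (u, v) ∉ F → S v := fun u v h1 h2 h3 =>
    Relation.ReflTransGen.tail h1 ⟨h2, h3⟩
  have ht : ¬ S t := hF2
  -- The objects reachable from the source: the tail lies in `S`, and a second half additionally
  -- needs its edge to be inserted.
  set rea : Fin 4 × V × V → Prop := fun x => S x.2.1 ∧ (((x.1 : ℕ) = 0 ∧ A x.2.1 x.2.2) ∨
    ((x.1 : ℕ) = 1 ∧ ¬ A x.2.1 x.2.2) ∨ ((x.1 : ℕ) = 2 ∧ ¬ A x.2.1 x.2.2 ∧ B x.2.1 x.2.2)) with hrea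
  refine ⟨Finset.univ.filter fun x => (x.1 : ℕ) ≠ 3 ∧ (¬ rea x ∨ ((x.1 : ℕ) ≠ 1 ∧ x.2 ∈ F)),
    Finset.univ.filter rea, ?_, ?_⟩
  · rintro ⟨c, u, v⟩ ⟨c', u', v'⟩ h
    simp only [Finset.mem_filter, Finset.mem_univ, true_and]
    by_contra hcon
    push Not at hcon
    obtain ⟨hx, hy⟩ := hcon
    simp only [hrea] at hx hy
    simp only [cutRel] at h
    have hout : (c : ℕ) = 0 ∨ (c : ℕ) = 2 → S v := by
      intro hc
      obtain ⟨hr, hf⟩ := hx (by omega)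
      refine hstep u v hr.1 ?_ (hf (by omega))
      rcases hr.2 with h | h | h
      · exact Or.inl h.2
      · omega
      · exact Or.inr h.2.2
    have hin : S u' → ((c' : ℕ) = 0 ∧ A u' v' ∨ (c' : ℕ) = 1 ∧ ¬ A u' v') → False :=
      fun h1 h2 => hy ⟨h1, h2.elim Or.inl fun h => Or.inr (Or.inl h)⟩
    rcases h with ⟨h1, h2, h3⟩ | ⟨h1, ⟨h2, h3⟩ | ⟨h2, h3, h4⟩⟩ | ⟨h1, h2, h3, h4⟩ | ⟨h1, h2, h3, h4⟩
    · obtain rfl : c = c' := Fin.ext h1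
      cases h3
      exact hy (hx h2).1
    · exact hin (h3 ▸ hout h2) h1
    · cases h3
      exact hin (h4 ▸ hs) h1
    · exact ht (h4 ▸ hout h1)
    · cases h3
      have hr := (hx (by omega)).1
      refine hy ⟨hr.1, Or.inr (Or.inr ⟨h2, ?_, h4⟩)⟩
      rcases hr.2 with h | h | h
      · omega
      · exact h.2
      · exact h.2.1
  · rw [← card_kind_ne_three]
    set K := Finset.univ.filter fun x : Fin 4 × V × V => (x.1 : ℕ) ≠ 3
    set CR := Finset.univ.filter fun x : Fin 4 × V × V =>
      (x.1 : ℕ) ≠ 3 ∧ (¬ rea x ∨ ((x.1 : ℕ) ≠ 1 ∧ x.2 ∈ F))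
    set CC := Finset.univ.filter rea
    rw [← Finset.card_union_add_card_inter]
    refine add_le_add (Finset.card_le_card ?_) ?_
    · intro x hx
      simp only [CR, CC, K, hrea, Finset.mem_union, Finset.mem_filter, Finset.mem_univ,
        true_and] at hx ⊢
      rcases hx with hx | hx
      · exact hx.1
      · omega
    · have hmem : ∀ x ∈ CR ∩ CC, rea x ∧ (x.1 : ℕ) ≠ 1 ∧ x.2 ∈ F := by
        intro x hx
        obtain ⟨h1, h2⟩ := Finset.mem_inter.1 hx
        have h2 := (Finset.mem_filter.1 h2).2
        exact ⟨h2, ((Finset.mem_filter.1 h1).2.2).resolve_left (not_not.2 h2)⟩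
      -- A pair has at most one reachable object of kind 0 or 2, according to whether it is in `A`;
      -- excluding kind 1 keeps a cut edge of `B` from being counted twice.
      refine Finset.card_le_card_of_injOn (fun x => x.2) (fun x hx => (hmem x hx).2.2) ?_
      rintro ⟨c, p⟩ hx ⟨c', p'⟩ hy hxy
      simp only at hxy
      subst hxy
      obtain ⟨⟨-, h1⟩, h2, -⟩ := hmem _ hx
      obtain ⟨⟨-, h3⟩, h4, -⟩ := hmem _ hy
      simp only at h1 h2 h3 h4
      have : c = c' := by
        apply Fin.ext
        rcases h1 with h1 | h1 | h1 <;> rcases h3 with h3 | h3 | h3 <;>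
          first | omega | exact absurd h1.2 h3.2.1 | exact absurd h3.2 h1.2.1
      rw [this]

/-- The diagonal forces every object of kind below 3 to pay at least once. The surplus of the cover,
namely double payments and elements of kind 3, marks the edges of a cut. -/
theorem exists_isSTCut_of_cover (A B : V → V → Prop) {s t : V} (hst : s ≠ t)
    (CR CC : Finset (Fin 4 × V × V))
    (hcov : ∀ x y, cutRel A B s t x.1 x.2 y.1 y.2 → x ∈ CR ∨ y ∈ CC) :
    ∃ F : Finset (V × V), IsSTCut ⟨fun u v => A u v ∨ B u v⟩ s t F ∧
      3 * Fintype.card V ^ 2 + F.card ≤ CR.card + CC.card := by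
  classical
  set F := Finset.univ.filter fun p : V × V => (A p.1 p.2 ∨ B p.1 p.2) ∧
    ((∃ c : Fin 4, (c : ℕ) ≠ 3 ∧ (c, p) ∈ CR ∧ (c, p) ∈ CC) ∨ (3, p) ∈ CR ∨ (3, p) ∈ CC) with hF
  refine ⟨F, ⟨by simp only [F, Finset.mem_filter]; tauto, ?_⟩, ?_⟩
  · intro hreach
    have hboth : ∀ (c : Fin 4) (p : V × V), (c : ℕ) ≠ 3 → (A p.1 p.2 ∨ B p.1 p.2) → p ∉ F →
        (c, p) ∈ CC → (c, p) ∉ CR := by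
      intro c p hc hp hpF h1 h2
      exact hpF (by simp only [F, Finset.mem_filter, Finset.mem_univ, true_and]; exact
        ⟨hp, Or.inl ⟨c, hc, h2, h1⟩⟩)
    -- Invariant along a path avoiding `F`: the row from which its last edge exits is uncovered. So
    -- the next column must be covered and, as there is no double payment, the next row is again
    -- uncovered. At `t` the sink column is then covered, which puts the last edge into `F`.
    have key : ∀ v, Relation.ReflTransGen (fun u v => (A u v ∨ B u v) ∧ (u, v) ∉ F) s v →
        v = s ∨ ∃ (c : Fin 4) (u : V), ((c : ℕ) = 0 ∨ (c : ℕ) = 2) ∧ (c, u, v) ∉ CR ∧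
          (A u v ∨ B u v) ∧ (u, v) ∉ F := by
      intro v hv
      induction hv with
      | refl => exact Or.inl rfl
      | @tail v w _ hvw ih =>
        right
        obtain ⟨hvw, hvwF⟩ := hvw
        have hin : ∀ c' : Fin 4, ((c' : ℕ) = 0 ∧ A v w ∨ (c' : ℕ) = 1 ∧ ¬ A v w) →
            (c', v, w) ∈ CC := by
          intro c' hc'
          rcases ih with rfl | ⟨c, u, hc, hcC, -, -⟩
          · refine (hcov (3, v, w) (c', v, w) (Or.inr (Or.inl ⟨hc', Or.inr ⟨rfl, rfl, rfl⟩⟩))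
              ).resolve_left ?_
            intro h
            exact hvwF (by simp only [F, Finset.mem_filter, Finset.mem_univ, true_and]; exact
              ⟨hvw, Or.inr (Or.inl h)⟩)
          · exact (hcov (c, u, v) (c', v, w) (Or.inr (Or.inl ⟨hc', Or.inl ⟨hc, rfl⟩⟩))
              ).resolve_left hcC
        by_cases hA : A v w
        · exact ⟨0, v, Or.inl rfl, hboth 0 (v, w) (by simp) hvw hvwF (hin 0 (Or.inl ⟨rfl, hA⟩)),
            hvw, hvwF⟩
        · have h1 := hboth 1 (v, w) (by simp) hvw hvwF (hin 1 (Or.inr ⟨rfl, hA⟩))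
          have h2 := (hcov (1, v, w) (2, v, w) (Or.inr (Or.inr (Or.inr
            ⟨rfl, rfl, rfl, hvw.resolve_left hA⟩)))).resolve_left h1
          exact ⟨2, v, Or.inr rfl, hboth 2 (v, w) (by simp) hvw hvwF h2, hvw, hvwF⟩
    rcases key t hreach with h | ⟨c, u, hc, hcC, hut, hutF⟩
    · exact hst h.symm
    · have := (hcov (c, u, t) (3, u, t) (Or.inr (Or.inr (Or.inl ⟨hc, rfl, rfl, rfl⟩)))
        ).resolve_left hcC
      exact hutF (by simp only [F, Finset.mem_filter, Finset.mem_univ, true_and]; exact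
              ⟨hut, Or.inr (Or.inr this)⟩)
  · rw [← card_kind_ne_three]
    set p : Fin 4 × V × V → Prop := fun x => (x.1 : ℕ) ≠ 3 with hp
    set K := Finset.univ.filter p
    have e1 := Finset.card_filter_add_card_filter_not (s := CR) p
    have e2 := Finset.card_filter_add_card_filter_not (s := CC) p
    have e3 := Finset.card_union_add_card_inter (CR.filter p) (CC.filter p)
    have e4 : K.card ≤ (CR.filter p ∪ CC.filter p).card := by
      refine Finset.card_le_card ?_
      intro x hx
      simp only [K, Finset.mem_filter, Finset.mem_univ, true_and, Finset.mem_union] at hx ⊢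
      have := hcov x x (Or.inl ⟨rfl, hx, rfl⟩)
      tauto
    have e5 : F ⊆ ((CR.filter p ∩ CC.filter p) ∪
        (CR.filter (fun x => ¬ p x) ∪ CC.filter fun x => ¬ p x)).image fun x => x.2 := by
      intro q hq
      simp only [F, Finset.mem_filter, Finset.mem_univ, true_and] at hq
      simp only [Finset.mem_image, Finset.mem_union, Finset.mem_inter, Finset.mem_filter]
      rcases hq.2 with ⟨c, h1, h2, h3⟩ | h | h
      · exact ⟨(c, q), Or.inl ⟨⟨h2, h1⟩, h3, h1⟩, rfl⟩
      · exact ⟨(3, q), Or.inr (Or.inl ⟨h, by simp [hp]⟩), rfl⟩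
      · exact ⟨(3, q), Or.inr (Or.inr ⟨h, by simp [hp]⟩), rfl⟩
    have e6 := (Finset.card_le_card e5).trans Finset.card_image_le
    have e7 := Finset.card_union_le (CR.filter p ∩ CC.filter p)
        (CR.filter (fun x => ¬ p x) ∪ CC.filter fun x => ¬ p x)
    have e8 := Finset.card_union_le (CR.filter (fun x => ¬ p x)) (CC.filter fun x => ¬ p x)
    omega

/-- The relation `cutRel` has a vertex cover and a matching of size `3 * n ^ 2 + lambda`, where
`lambda` is the edge-connectivity of the digraph `A ∨ B`. -/
theorem cutRel_cover_matching (A B : V → V → Prop) {s t : V} (hst : s ≠ t) {m : ℕ}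
    (hm : 3 * Fintype.card V ^ 2 + stEdgeConnectivity ⟨fun u v => A u v ∨ B u v⟩ s t = m) :
    (∃ CR CC : Finset (Fin 4 × V × V),
      (∀ x y, cutRel A B s t x.1 x.2 y.1 y.2 → x ∈ CR ∨ y ∈ CC) ∧ CR.card + CC.card = m) ∧
    ∃ f g : Fin m → Fin 4 × V × V, f.Injective ∧ g.Injective ∧
      ∀ i, cutRel A B s t (f i).1 (f i).2 (g i).1 (g i).2 := by
  classical
  obtain ⟨CR, CC, hcov, f, g, hf, hg, hfg⟩ := exists_cover_matching
    fun x y : Fin 4 × V × V => cutRel A B s t x.1 x.2 y.1 y.2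
  obtain ⟨F, hF, hFc⟩ := exists_isSTCut_of_cover A B hst CR CC hcov
  have hle : stEdgeConnectivity ⟨fun u v => A u v ∨ B u v⟩ s t ≤ F.card := Nat.sInf_le ⟨F, hF, rfl⟩
  obtain ⟨F', hF', hFc'⟩ : stEdgeConnectivity ⟨fun u v => A u v ∨ B u v⟩ s t ∈
      {c | ∃ F : Finset (V × V), IsSTCut ⟨fun u v => A u v ∨ B u v⟩ s t F ∧ F.card = c} :=
    Nat.sInf_mem ⟨_, F, hF, rfl⟩
  obtain ⟨CR', CC', hcov', hc'⟩ := exists_cover_of_isSTCut A B s t F' hF'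
  -- Each matching edge uses its own element of any other cover, so König's cover is no larger than
  -- the one built from a minimum cut.
  have hle' : CR.card + CC.card ≤ CR'.card + CC'.card := by
    have hin : ∀ i, f i ∈ CR' ∨ g i ∈ CC' := fun i => hcov' _ _ (hfg i)
    have h1 : (Finset.univ.filter fun i => f i ∈ CR').card ≤ CR'.card :=
      Finset.card_le_card_of_injOn f (by intro i; simp) hf.injOn
    have h2 : (Finset.univ.filter fun i => ¬ f i ∈ CR').card ≤ CC'.card :=
      Finset.card_le_card_of_injOn g (by intro i hi; simp at hi; exact (hin i).resolve_left hi)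
        hg.injOn
    have h3 := Finset.card_filter_add_card_filter_not
      (s := (Finset.univ : Finset (Fin (CR.card + CC.card)))) (fun i => f i ∈ CR')
    rw [Finset.card_univ, Fintype.card_fin] at h3
    omega
  have : CR.card + CC.card = m := by omega
  subst this
  exact ⟨⟨CR, CC, hcov, rfl⟩, f, g, hf, hg, hfg⟩

end CutRel

/-! ### Matching numbers certified by covers -/

/-- The bipartite graph of a relation. -/
def relGraph {α β : Type*} (r : α → β → Prop) : SimpleGraph (α ⊕ β) where
  Adj x y := (∃ a b, x = Sum.inl a ∧ y = Sum.inr b ∧ r a b) ∨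
    ∃ a b, y = Sum.inl a ∧ x = Sum.inr b ∧ r a b
  symm := ⟨fun _ _ h => h.symm⟩
  loopless := ⟨by rintro x (⟨a, b, rfl, h, -⟩ | ⟨a, b, rfl, h, -⟩) <;> simp at h⟩

theorem map_adj_of_injective {V W : Type*} {f : V → W} (hf : f.Injective) (G : SimpleGraph V)
    (u v : W) : (G.map f).Adj u v ↔ ∃ u' v' : V, G.Adj u' v' ∧ f u' = u ∧ f v' = v :=
  SimpleGraph.map_adj ⟨f, hf⟩ G u v

/-- Charge each matching edge to an endpoint in the cover; no vertex is charged twice. -/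
theorem ncard_edgeSet_le_of_cover {W : Type*} [Finite W] {G : SimpleGraph W} (C : Finset W)
    (hC : ∀ u v, G.Adj u v → u ∈ C ∨ v ∈ C) {M : G.Subgraph} (hM : M.IsMatching) :
    M.edgeSet.ncard ≤ C.card := by
  classical
  have h : ∀ x ∈ M.edgeSet, ∃ v ∈ C, v ∈ x := by
    intro x
    induction x using Sym2.ind with
    | _ u v =>
      intro hx
      rcases hC u v (M.adj_sub hx) with h | h
      · exact ⟨u, h, by simp⟩
      · exact ⟨v, h, by simp⟩
  have h' : ∀ x, ∃ v, x ∈ M.edgeSet → v ∈ C ∧ v ∈ x := fun x =>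
    if hx : x ∈ M.edgeSet then (h x hx).imp fun _ h _ => h else ⟨x.out.1, fun h => absurd h hx⟩
  choose φ hφ using h'
  rw [← Set.ncard_coe_finset]
  refine Set.ncard_le_ncard_of_injOn φ (fun x hx => (hφ x hx).1) ?_ C.finite_toSet
  intro x hx y hy hxy
  have h1 := (hφ x hx).2
  have h2 := (hφ y hy).2
  rw [← hxy] at h2
  obtain ⟨w, hw⟩ := Sym2.mem_iff_exists.1 h1
  obtain ⟨w', hw'⟩ := Sym2.mem_iff_exists.1 h2
  rw [hw] at hx
  rw [hw'] at hy
  rw [hw, hw', show w = w' from hM.eq_of_adj_left hx hy]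

theorem matchingNumber_eq_of_cover_of_matching {W : Type} [Finite W] (G : SimpleGraph W) {m : ℕ}
    (C : Finset W) (hC : ∀ u v, G.Adj u v → u ∈ C ∨ v ∈ C) (hCm : C.card = m)
    (f g : Fin m → W) (hf : f.Injective) (hg : g.Injective) (hfg : ∀ i j, f i ≠ g j)
    (hadj : ∀ i, G.Adj (f i) (g i)) : matchingNumber G = m := by
  refine IsGreatest.csSup_eq ⟨?_, ?_⟩
  · refine ⟨⟨Set.range f ∪ Set.range g,
      fun u v => ∃ i, (u = f i ∧ v = g i) ∨ (u = g i ∧ v = f i), ?_, ?_, ?_⟩, ?_, ?_⟩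
    · rintro u v ⟨i, ⟨rfl, rfl⟩ | ⟨rfl, rfl⟩⟩
      · exact hadj i
      · exact (hadj i).symm
    · rintro u v ⟨i, ⟨rfl, rfl⟩ | ⟨rfl, rfl⟩⟩
      · exact Or.inl ⟨i, rfl⟩
      · exact Or.inr ⟨i, rfl⟩
    · exact ⟨fun u v ⟨i, h⟩ => ⟨i, by tauto⟩⟩
    · rintro v (⟨i, rfl⟩ | ⟨i, rfl⟩)
      · refine ⟨g i, ⟨i, Or.inl ⟨rfl, rfl⟩⟩, ?_⟩
        rintro w ⟨j, ⟨h, rfl⟩ | ⟨h, rfl⟩⟩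
        · rw [hf h]
        · exact absurd h (hfg i j)
      · refine ⟨f i, ⟨i, Or.inr ⟨rfl, rfl⟩⟩, ?_⟩
        rintro w ⟨j, ⟨h, rfl⟩ | ⟨h, rfl⟩⟩
        · exact absurd h.symm (hfg j i)
        · rw [hg h]
    · refine (congr_arg Set.ncard (a₂ := Set.range fun i => s(f i, g i)) ?_).trans ?_
      · ext x
        induction x using Sym2.ind with
        | _ u v =>
          rw [SimpleGraph.Subgraph.mem_edgeSet]
          simp only [Set.mem_range, Sym2.eq_iff]
          refine exists_congr fun i => ?_
          constructor
          · rintro (⟨rfl, rfl⟩ | ⟨rfl, rfl⟩) <;> simp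
          · rintro (⟨rfl, rfl⟩ | ⟨rfl, rfl⟩) <;> simp
      · rw [← Set.image_univ, Set.ncard_image_of_injective, Set.ncard_univ,
          Nat.card_eq_fintype_card, Fintype.card_fin]
        intro i j h
        rcases Sym2.eq_iff.1 h with h | h
        · exact hf h.1
        · exact absurd h.1 (hfg i j)
  · rintro _ ⟨M, hM, rfl⟩
    exact (ncard_edgeSet_le_of_cover C hC hM).trans hCm.le

/-- The matching number of a bipartite graph, given by a relation up to renaming of the vertices,
that has a vertex cover and a matching of the same size. -/
theorem matchingNumber_eq_of_rel {α β W : Type} [Finite W] {r : α → β → Prop} (e : α ⊕ β ≃ W)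
    {G : SimpleGraph W} (hG : ∀ x y, G.Adj (e x) (e y) ↔ (relGraph r).Adj x y) {m : ℕ}
    (A : Finset α) (B : Finset β) (hAB : ∀ a b, r a b → a ∈ A ∨ b ∈ B) (hm : A.card + B.card = m)
    (f : Fin m → α) (g : Fin m → β) (hf : f.Injective) (hg : g.Injective)
    (hfg : ∀ i, r (f i) (g i)) : matchingNumber G = m := by
  refine matchingNumber_eq_of_cover_of_matching G ((A.disjSum B).map e.toEmbedding) ?_
    (by simpa using hm) (fun i => e (Sum.inl (f i))) (fun i => e (Sum.inr (g i))) ?_ ?_ ?_ ?_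
  · intro u v huv
    obtain ⟨x, rfl⟩ := e.surjective u
    obtain ⟨y, rfl⟩ := e.surjective v
    rw [hG] at huv
    rcases huv with ⟨a, b, rfl, rfl, h⟩ | ⟨a, b, rfl, rfl, h⟩
    · simpa using hAB a b h
    · simpa using (hAB a b h).symm
  · exact e.injective.comp (Sum.inl_injective.comp hf)
  · exact e.injective.comp (Sum.inr_injective.comp hg)
  · intro i j h
    simpa using e.injective h
  · intro i
    rw [hG]
    exact Or.inl ⟨_, _, rfl, rfl, hfg i⟩

/-! ### From connectivity queries to matching queries -/

/-- The edges on `4 * k ^ 2` labelled terminals, four for each ordered pair of original terminals,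
that simulate a connectivity query: the first two terminals of each queried pair and the last two
of each pair that is not queried are joined. -/
def queryEdges {k : ℕ} (Q : Query k) : SimpleGraph (Fin 4 × Fin k × Fin k) where
  Adj x y := x.2 = y.2 ∧
    ((Q x.2.1 x.2.2 = true ∧ ((x.1 = 0 ∧ y.1 = 1) ∨ (x.1 = 1 ∧ y.1 = 0))) ∨
      (Q x.2.1 x.2.2 = false ∧ ((x.1 = 2 ∧ y.1 = 3) ∨ (x.1 = 3 ∧ y.1 = 2))))
  symm := ⟨by rintro ⟨a, p⟩ ⟨b, p'⟩ ⟨h, h'⟩; simp only at h; subst h; exact ⟨rfl, by tauto⟩⟩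
  loopless := ⟨by
    rintro ⟨a, p⟩ ⟨-, h⟩
    simp only at h
    rcases h with ⟨-, ⟨rfl, h⟩ | ⟨rfl, h⟩⟩ | ⟨-, ⟨rfl, h⟩ | ⟨rfl, h⟩⟩ <;> exact absurd h (by decide)⟩

namespace STInstance

variable {k n : ℕ}

/-- The edges inserted by a query. -/
def queryRel (I : STInstance k n) (Q : Query k) (u v : Fin n) : Prop :=
  ∃ i j, Q i j = true ∧ I.terminal i = u ∧ I.terminal j = v

theorem cutRel_cover_matching (I : STInstance k n) (Q : Query k) :
    (∃ CR CC : Finset (Fin 4 × Fin n × Fin n),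
      (∀ x y, cutRel I.graph.Adj (I.queryRel Q) I.s I.t x.1 x.2 y.1 y.2 → x ∈ CR ∨ y ∈ CC) ∧
        CR.card + CC.card = 3 * n ^ 2 + I.answer Q) ∧
    ∃ f g : Fin (3 * n ^ 2 + I.answer Q) → Fin 4 × Fin n × Fin n, f.Injective ∧ g.Injective ∧
      ∀ i, cutRel I.graph.Adj (I.queryRel Q) I.s I.t (f i).1 (f i).2 (g i).1 (g i).2 :=
  _root_.cutRel_cover_matching I.graph.Adj (I.queryRel Q) I.s_ne_t (by rw [Fintype.card_fin]; rfl)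

/-- The relation of the auxiliary bipartite graph after the insertion of the query edges. -/
def auxRel (I : STInstance k n) (Q : Query k) :
    (Fin 4 × Fin n × Fin n) ⊕ (Fin k × Fin k) → (Fin 4 × Fin n × Fin n) ⊕ (Fin k × Fin k) → Prop
  | Sum.inl x, Sum.inl y => cutRel I.graph.Adj (I.queryRel Q) I.s I.t x.1 x.2 y.1 y.2
  | Sum.inr p, Sum.inr p' => p = p' ∧ Q p.1 p.2 = false
  | _, _ => False

/-- The relation of the auxiliary bipartite graph before the insertion of any query edges. -/
def auxBaseRel (I : STInstance k n) :
    (Fin 4 × Fin n × Fin n) ⊕ (Fin k × Fin k) → (Fin 4 × Fin n × Fin n) ⊕ (Fin k × Fin k) → Prop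
  | Sum.inl x, Sum.inl y => cutRel I.graph.Adj (fun _ _ => False) I.s I.t x.1 x.2 y.1 y.2
  | _, _ => False

/-- The terminals of the auxiliary bipartite graph. -/
def auxTerminal (I : STInstance k n) : Fin 4 × Fin k × Fin k →
    ((Fin 4 × Fin n × Fin n) ⊕ (Fin k × Fin k)) ⊕ ((Fin 4 × Fin n × Fin n) ⊕ (Fin k × Fin k))
  | (0, p) => Sum.inl (Sum.inl (1, I.terminal p.1, I.terminal p.2))
  | (1, p) => Sum.inr (Sum.inl (2, I.terminal p.1, I.terminal p.2))
  | (2, p) => Sum.inl (Sum.inr p)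
  | (3, p) => Sum.inr (Sum.inr p)

theorem auxTerminal_injective (I : STInstance k n) : Function.Injective I.auxTerminal := by
  rintro ⟨a, p⟩ ⟨b, p'⟩ h
  fin_cases a <;> fin_cases b <;> simp [auxTerminal, Prod.ext_iff] at h ⊢ <;> exact h

/-- The inserted edges occur only in the last clause of `cutRel`, which is exactly what joining
terminals 0 and 1 restores; joining terminals 2 and 3 gives the isolated edges. -/
theorem relGraph_auxRel (I : STInstance k n) (Q : Query k) :
    relGraph I.auxBaseRel ⊔ (queryEdges Q).map I.auxTerminal =
      relGraph (I.auxRel Q) := by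
  have key : ∀ a b, (I.auxRel Q a b ↔ I.auxBaseRel a b ∨ ∃ x y, (queryEdges Q).Adj x y ∧
      I.auxTerminal x = Sum.inl a ∧ I.auxTerminal y = Sum.inr b) := by
    intro a b
    constructor
    · rcases a with x | p <;> rcases b with y | p' <;> intro h
      · rcases h with h | h | h | ⟨h1, h2, h3, i, j, hQ, hi, hj⟩
        · exact Or.inl (Or.inl h)
        · exact Or.inl (Or.inr (Or.inl h))
        · exact Or.inl (Or.inr (Or.inr (Or.inl h)))
        · right
          refine ⟨(0, i, j), (1, i, j), ⟨rfl, Or.inl ⟨hQ, Or.inl ⟨rfl, rfl⟩⟩⟩, ?_, ?_⟩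
          · simp only [auxTerminal, hi, hj, Sum.inl.injEq]
            exact Prod.ext (Fin.ext h1.symm) rfl
          · simp only [auxTerminal, hi, hj, Sum.inr.injEq, Sum.inl.injEq]
            exact Prod.ext (Fin.ext h2.symm) h3
      · exact h.elim
      · exact h.elim
      · obtain ⟨rfl, h⟩ := h
        exact Or.inr ⟨(2, p), (3, p), ⟨rfl, Or.inr ⟨h, Or.inl ⟨rfl, rfl⟩⟩⟩, rfl, rfl⟩
    · rintro (h | ⟨⟨c, p⟩, ⟨c', p'⟩, ⟨hp, h⟩, h1, h2⟩)
      · rcases a with x | p <;> rcases b with y | p'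
        · rcases h with h | h | h | ⟨-, -, -, h⟩
          · exact Or.inl h
          · exact Or.inr (Or.inl h)
          · exact Or.inr (Or.inr (Or.inl h))
          · exact h.elim
        · exact h
        · exact h
        · exact h.elim
      · simp only at hp h
        subst hp
        rcases h with ⟨hQ, ⟨rfl, rfl⟩ | ⟨rfl, rfl⟩⟩ | ⟨hQ, ⟨rfl, rfl⟩ | ⟨rfl, rfl⟩⟩
        · simp only [auxTerminal, Sum.inl.injEq, Sum.inr.injEq] at h1 h2
          subst h1 h2
          exact Or.inr (Or.inr (Or.inr ⟨rfl, rfl, rfl, p.1, p.2, hQ, rfl, rfl⟩))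
        · simp [auxTerminal] at h1
        · simp only [auxTerminal, Sum.inl.injEq, Sum.inr.injEq] at h1 h2
          subst h1 h2
          exact ⟨rfl, hQ⟩
        · simp [auxTerminal] at h1
  have hside : ∀ x y, (queryEdges Q).Adj x y →
      (∃ a b, I.auxTerminal x = Sum.inl a ∧ I.auxTerminal y = Sum.inr b) ∨
      ∃ a b, I.auxTerminal x = Sum.inr a ∧ I.auxTerminal y = Sum.inl b := by
    rintro ⟨c, p⟩ ⟨c', p'⟩ ⟨-, h⟩
    simp only at h
    rcases h with ⟨-, ⟨rfl, rfl⟩ | ⟨rfl, rfl⟩⟩ | ⟨-, ⟨rfl, rfl⟩ | ⟨rfl, rfl⟩⟩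
    · exact Or.inl ⟨_, _, rfl, rfl⟩
    · exact Or.inr ⟨_, _, rfl, rfl⟩
    · exact Or.inl ⟨_, _, rfl, rfl⟩
    · exact Or.inr ⟨_, _, rfl, rfl⟩
  ext u v
  rw [SimpleGraph.sup_adj, map_adj_of_injective I.auxTerminal_injective]
  constructor
  · rintro ((⟨a, b, rfl, rfl, h⟩ | ⟨a, b, rfl, rfl, h⟩) | ⟨x, y, h, rfl, rfl⟩)
    · exact Or.inl ⟨a, b, rfl, rfl, (key a b).2 (Or.inl h)⟩
    · exact Or.inr ⟨a, b, rfl, rfl, (key a b).2 (Or.inl h)⟩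
    · rcases hside x y h with ⟨a, b, ha, hb⟩ | ⟨b, a, hb, ha⟩
      · exact Or.inl ⟨a, b, ha, hb, (key a b).2 (Or.inr ⟨x, y, h, ha, hb⟩)⟩
      · exact Or.inr ⟨a, b, ha, hb, (key a b).2 (Or.inr ⟨y, x, h.symm, ha, hb⟩)⟩
  · rintro (⟨a, b, rfl, rfl, h⟩ | ⟨a, b, rfl, rfl, h⟩)
    · rcases (key a b).1 h with h | ⟨x, y, h, ha, hb⟩
      · exact Or.inl (Or.inl ⟨a, b, rfl, rfl, h⟩)
      · exact Or.inr ⟨x, y, h, ha, hb⟩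
    · rcases (key a b).1 h with h | ⟨x, y, h, ha, hb⟩
      · exact Or.inl (Or.inr ⟨a, b, rfl, rfl, h⟩)
      · exact Or.inr ⟨y, x, h.symm, hb, ha⟩

/-- The isolated edges of the k² - |Q| unqueried pairs extend both the matching and, through their
row ends, the cover. -/
theorem auxRel_cover_matching (I : STInstance k n) (Q : Query k) {m : ℕ}
    (hm : m + Q.size = 3 * n ^ 2 + I.answer Q + k ^ 2) :
    (∃ A B : Finset ((Fin 4 × Fin n × Fin n) ⊕ (Fin k × Fin k)),
      (∀ a b, I.auxRel Q a b → a ∈ A ∨ b ∈ B) ∧ A.card + B.card = m) ∧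
    ∃ f g : Fin m → (Fin 4 × Fin n × Fin n) ⊕ (Fin k × Fin k), f.Injective ∧ g.Injective ∧
      ∀ i, I.auxRel Q (f i) (g i) := by
  obtain ⟨⟨CR, CC, hcov, hc⟩, f, g, hf, hg, hfg⟩ := I.cutRel_cover_matching Q
  set D := Finset.univ.filter fun p : Fin k × Fin k => Q p.1 p.2 = false with hD
  have hDc : D.card + Q.size = k ^ 2 := by
    have := Finset.card_filter_add_card_filter_not (s := (Finset.univ : Finset (Fin k × Fin k)))
      (fun p => Q p.1 p.2 = false)
    simp only [Bool.not_eq_false, Finset.card_univ, Fintype.card_prod, Fintype.card_fin] at this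
    rw [sq, ← this]
    rfl
  refine ⟨⟨CR.disjSum D, CC.disjSum ∅, ?_, ?_⟩, ?_⟩
  · rintro (x | p) (y | p') h
    · simpa using hcov x y h
    · exact h.elim
    · exact h.elim
    · simp only [Finset.inr_mem_disjSum, D, Finset.mem_filter, Finset.mem_univ, true_and]
      exact Or.inl h.2
  · simp only [Finset.card_disjSum, Finset.card_empty]
    omega
  · have e : Fin m ≃ Fin (3 * n ^ 2 + I.answer Q) ⊕ D := Fintype.equivOfCardEq (by
      simp only [Fintype.card_fin, Fintype.card_sum, Fintype.card_coe]
      omega)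
    refine ⟨Sum.map f Subtype.val ∘ e, Sum.map g Subtype.val ∘ e,
      (hf.sumMap Subtype.val_injective).comp e.injective,
      (hg.sumMap Subtype.val_injective).comp e.injective, ?_⟩
    intro i
    simp only [Function.comp_apply]
    rcases e i with j | ⟨p, hp⟩
    · exact hfg j
    · exact ⟨rfl, (Finset.mem_filter.1 hp).2⟩

end STInstance

/-- Connectivity queries reduce to maximum-matching queries on an auxiliary bipartite graph. -/
theorem exists_matching_reduction : ∃ C : ℕ, ∀ k : ℕ,
    ∃ matchingQuery : Query k → SimpleGraph (Fin (4 * k ^ 2)),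
      ∀ (n : ℕ) (I : STInstance k n),
        ∃ (N : ℕ) (G' : SimpleGraph (Fin N)) (terminal' : Fin (4 * k ^ 2) ↪ Fin N)
          (side : Fin N → Bool) (m : ℕ),
          N ≤ C * n ^ 2 ∧
          ∀ Q : Query k,
            (∀ u v, (G' ⊔ (matchingQuery Q).map terminal').Adj u v → side u ≠ side v) ∧
            matchingNumber (G' ⊔ (matchingQuery Q).map terminal') + Q.size =
              I.answer Q + (m + 2 * k ^ 2) := by
  -- The auxiliary graph has 8n² + 2k² vertices, and k ≤ n because the terminals are distinct.
  refine ⟨10, fun k => ?_⟩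
  have e₁ : Fin 4 × Fin k × Fin k ≃ Fin (4 * k ^ 2) := Fintype.equivOfCardEq (by simp [sq])
  refine ⟨fun Q => (queryEdges Q).map e₁.toEmbedding, fun n I => ?_⟩
  have e₂ : ((Fin 4 × Fin n × Fin n) ⊕ (Fin k × Fin k)) ⊕
      ((Fin 4 × Fin n × Fin n) ⊕ (Fin k × Fin k)) ≃ Fin (8 * n ^ 2 + 2 * k ^ 2) :=
    Fintype.equivOfCardEq (by simp; ring)
  have hkn : k ≤ n := by simpa using Fintype.card_le_of_embedding I.terminal
  set T : Fin 4 × Fin k × Fin k ↪ _ := ⟨I.auxTerminal, I.auxTerminal_injective⟩ with hT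
  have hsup : ∀ Q : Query k, (relGraph I.auxBaseRel).map e₂.toEmbedding ⊔
      ((queryEdges Q).map e₁.toEmbedding).map
        ((e₁.symm.toEmbedding.trans T).trans e₂.toEmbedding) =
      (relGraph (I.auxRel Q)).map e₂.toEmbedding := by
    intro Q
    have hcomp : ⇑((e₁.symm.toEmbedding.trans T).trans e₂.toEmbedding) ∘ ⇑e₁.toEmbedding =
        e₂ ∘ I.auxTerminal := by
      ext x
      simp [hT]
    rw [← I.relGraph_auxRel Q, SimpleGraph.map_map, hcomp]
    ext u v
    rw [SimpleGraph.sup_adj, map_adj_of_injective (e₂.injective.comp I.auxTerminal_injective),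
      SimpleGraph.map_adj, SimpleGraph.map_adj]
    simp only [SimpleGraph.sup_adj, map_adj_of_injective I.auxTerminal_injective,
      Equiv.coe_toEmbedding, Function.comp_apply]
    constructor
    · rintro (⟨a, b, h, rfl, rfl⟩ | ⟨a, b, h, rfl, rfl⟩)
      · exact ⟨a, b, Or.inl h, rfl, rfl⟩
      · exact ⟨_, _, Or.inr ⟨a, b, h, rfl, rfl⟩, rfl, rfl⟩
    · rintro ⟨_, _, h | ⟨a, b, h, rfl, rfl⟩, rfl, rfl⟩
      · exact Or.inl ⟨_, _, h, rfl, rfl⟩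
      · exact Or.inr ⟨a, b, h, rfl, rfl⟩
  -- The offset satisfies m + 2k² = 3n² + k²; the subtraction in m = 3n² - k² is not truncated since
  -- k ≤ n.
  refine ⟨8 * n ^ 2 + 2 * k ^ 2, (relGraph I.auxBaseRel).map e₂.toEmbedding,
    (e₁.symm.toEmbedding.trans T).trans e₂.toEmbedding, fun v => (e₂.symm v).isLeft,
    3 * n ^ 2 - k ^ 2, ?_, fun Q => ?_⟩
  · have := Nat.pow_le_pow_left hkn 2
    omega
  · rw [hsup]
    constructor
    · rintro u v h
      rw [SimpleGraph.map_adj] at h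
      obtain ⟨x, y, h, rfl, rfl⟩ := h
      rcases h with ⟨a, b, rfl, rfl, -⟩ | ⟨a, b, rfl, rfl, -⟩ <;> simp
    · have hsize : Q.size ≤ k ^ 2 := by
        refine (Finset.card_le_univ _).trans (by simp [sq])
      have hkn2 := Nat.pow_le_pow_left hkn 2
      obtain ⟨⟨A, B, hcov, hc⟩, f, g, hf, hg, hfg⟩ := I.auxRel_cover_matching Q
        (m := 3 * n ^ 2 + I.answer Q + k ^ 2 - Q.size) (by omega)
      rw [matchingNumber_eq_of_rel e₂ (fun x y => ?_) A B hcov hc f g hf hg hfg]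
      · omega
      · simpa using SimpleGraph.map_adj_apply (f := e₂.toEmbedding)

/-! ### Nullity compression and ranks of random matrices -/

section LinearAlgebra

variable {F : Type*} [Field F]

theorem exists_linearMap_ker_eq {V W : Type*} [AddCommGroup V] [Module F V] [AddCommGroup W]
    [Module F W] [Module.Finite F V] [Module.Finite F W]
    (h : Module.finrank F V ≤ Module.finrank F W) (Z : Submodule F V) :
    ∃ L : V →ₗ[F] W, LinearMap.ker L = Z := by
  have h1 : Module.finrank F (V ⧸ Z) ≤ Module.finrank F W := by
    have := Submodule.finrank_quotient_add_finrank Z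
    omega
  obtain ⟨f, hf⟩ := finrank_le_iff_exists_linearMap.1 h1
  refine ⟨f.comp Z.mkQ, ?_⟩
  rw [LinearMap.ker_comp_of_ker_eq_bot _ (LinearMap.ker_eq_bot.2 hf), Submodule.ker_mkQ]

/-- The nullity of a matrix in which `q` entries are switched on and off is, up to a constant, that
of a matrix with `q` columns and at most `2 * q` rows, whose columns are modified accordingly. -/
theorem exists_small_matrix_nullity {R C q ι : Type*} [Fintype R] [Fintype C] [Fintype q]
    [Fintype ι] [DecidableEq R] [DecidableEq C] [DecidableEq q]
    (hι : 2 * Fintype.card q ≤ Fintype.card ι)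
    (M : Matrix R C F) (row : q → R) (col : q → C) (w : q → F) :
    ∃ κ ≤ Fintype.card C, ∃ E H : Matrix ι q F, ∀ x : q → F,
      Module.finrank F
        (LinearMap.ker (M + ∑ b, Matrix.single (row b) (col b) (x b * w b)).mulVecLin) =
      κ + Module.finrank F (LinearMap.ker (E + H * Matrix.diagonal x).mulVecLin) := by
  set π : (C → F) →ₗ[F] (q → F) := LinearMap.funLeft F F col with hπ
  set T : (q → F) →ₗ[F] (R → F) := ∑ b, (LinearMap.single F (fun _ => F) (row b)).comp
    ((w b) • LinearMap.proj b) with hT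
  set K0 := LinearMap.ker (π.prod M.mulVecLin) with hK0
  -- `Z` consists of the pairs (η, ζ) such that some `y` restricts to η on the switched columns and
  -- satisfies `M y + T ζ = 0`. It does not depend on `x` and lies in dimension 2|q|, so it is the
  -- kernel of a map `L = [E | H]` into `ι → F`.
  set Z : Submodule F ((q → F) × (q → F)) := (LinearMap.ker
    ((M.mulVecLin.comp (LinearMap.fst F (C → F) (q → F))) +
      T.comp (LinearMap.snd F (C → F) (q → F)))).map (π.prodMap LinearMap.id) with hZ
  obtain ⟨L, hL⟩ := exists_linearMap_ker_eq (W := ι → F) (by simp; omega) Z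
  have hκ : Module.finrank F K0 ≤ Fintype.card C := by
    simpa using Submodule.finrank_le K0
  refine ⟨Module.finrank F K0, hκ, LinearMap.toMatrix' (L.comp (LinearMap.inl F _ _)),
    LinearMap.toMatrix' (L.comp (LinearMap.inr F _ _)), fun x => ?_⟩
  set N := M + ∑ b, Matrix.single (row b) (col b) (x b * w b) with hN
  have hNT : ∀ y, N.mulVec y = M.mulVec y + T (fun b => x b * y (col b)) := by
    intro y
    rw [hN, Matrix.add_mulVec, Matrix.sum_mulVec, hT]
    congr 1
    rw [LinearMap.sum_apply]
    refine Finset.sum_congr rfl fun b _ => ?_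
    rw [Matrix.single_mulVec]
    ext i
    simp only [LinearMap.comp_apply, LinearMap.smul_apply, LinearMap.proj_apply, smul_eq_mul,
      LinearMap.single_apply, Pi.single_apply, Function.update_apply, Pi.zero_apply]
    split_ifs
    · ring
    · rfl
  have hsmall : ∀ η : q → F, (LinearMap.toMatrix' (L.comp (LinearMap.inl F _ _)) +
      LinearMap.toMatrix' (L.comp (LinearMap.inr F _ _)) * Matrix.diagonal x).mulVec η =
      L (η, fun b => x b * η b) := by
    intro η
    rw [Matrix.add_mulVec, ← Matrix.mulVec_mulVec, LinearMap.toMatrix'_mulVec,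
      LinearMap.toMatrix'_mulVec]
    have : (Matrix.diagonal x).mulVec η = fun b => x b * η b := by
      ext b; simp [Matrix.mulVec_diagonal]
    rw [this, LinearMap.comp_apply, LinearMap.comp_apply, ← map_add]
    simp
  -- Rank-nullity for the restriction of kernel vectors to the switched columns. Its kernel is `K0`,
  -- where the switches have no effect; its range is the set of η with (η, xη) in `Z`, which is the
  -- kernel of `E + H diag(x)`.
  set P : LinearMap.ker N.mulVecLin →ₗ[F] (q → F) := π.comp (Submodule.subtype _) with hP
  rw [← LinearMap.finrank_range_add_finrank_ker P, add_comm]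
  congr 1
  · refine LinearEquiv.finrank_eq ?_
    have hx : ∀ y, y ∈ K0 ↔ y ∈ LinearMap.ker N.mulVecLin ∧ π y = 0 := by
      intro y
      rw [hK0, LinearMap.mem_ker, LinearMap.prod_apply, Function.prod_apply, Prod.mk_eq_zero,
        LinearMap.mem_ker, Matrix.mulVecLin_apply, Matrix.mulVecLin_apply, hNT]
      have : π y = 0 → (fun b => x b * y (col b)) = 0 := by
        intro h
        ext b
        have := congr_fun h b
        simp only [hπ, LinearMap.funLeft_apply, Pi.zero_apply] at this
        simp [this]
      constructor
      · rintro ⟨h1, h2⟩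
        rw [this h1, h2]
        simp [h1]
      · rintro ⟨h1, h2⟩
        rw [this h2, map_zero, add_zero] at h1
        exact ⟨h2, h1⟩
    refine LinearEquiv.ofBijective ((Submodule.subtype (LinearMap.ker N.mulVecLin)).comp
      (Submodule.subtype (LinearMap.ker P)) |>.codRestrict K0 ?_) ⟨?_, ?_⟩
    · rintro ⟨⟨y, hy⟩, hy'⟩
      exact (hx y).2 ⟨hy, hy'⟩
    · rintro ⟨⟨y, hy⟩, hy'⟩ ⟨⟨z, hz⟩, hz'⟩ h
      simpa using congr_arg Subtype.val h
    · rintro ⟨y, hy⟩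
      obtain ⟨h1, h2⟩ := (hx y).1 hy
      exact ⟨⟨⟨y, h1⟩, h2⟩, rfl⟩
  · have : LinearMap.range P = LinearMap.ker (LinearMap.toMatrix' (L.comp (LinearMap.inl F _ _)) +
        LinearMap.toMatrix' (L.comp (LinearMap.inr F _ _)) * Matrix.diagonal x).mulVecLin := by
      ext η
      rw [LinearMap.mem_ker, Matrix.mulVecLin_apply, hsmall, ← LinearMap.mem_ker, hL, hZ,
        Submodule.mem_map, LinearMap.mem_range]
      constructor
      · rintro ⟨⟨y, hy⟩, rfl⟩
        refine ⟨(y, fun b => x b * y (col b)), ?_, rfl⟩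
        rw [LinearMap.mem_ker, Matrix.mulVecLin_apply, hNT] at hy
        simpa using hy
      · rintro ⟨⟨y, ζ⟩, hy, h⟩
        simp only [LinearMap.prodMap_apply, LinearMap.id_apply, Prod.mk.injEq] at h
        obtain ⟨rfl, rfl⟩ := h
        refine ⟨⟨y, ?_⟩, rfl⟩
        rw [LinearMap.mem_ker, Matrix.mulVecLin_apply, hNT]
        exact hy
    rw [this]

/-- Every column outside `B` is a combination of the unit vectors at the rows in `A`. -/
theorem Matrix.rank_le_of_cover {R C : Type*} [Fintype R] [Fintype C] [DecidableEq R]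
    (M : Matrix R C F) (A : Finset R) (B : Finset C) (h : ∀ a b, M a b ≠ 0 → a ∈ A ∨ b ∈ B) :
    M.rank ≤ A.card + B.card := by
  classical
  rw [Matrix.rank_eq_finrank_span_cols]
  set S : Finset (R → F) := A.image (fun a => Pi.single a 1) ∪ B.image M.col
  have hS : Submodule.span F (Set.range M.col) ≤ Submodule.span F (S : Set (R → F)) := by
    rw [Submodule.span_le]
    rintro _ ⟨b, rfl⟩
    by_cases hb : b ∈ B
    · exact Submodule.subset_span (Finset.mem_coe.2 (Finset.mem_union_right _
        (Finset.mem_image_of_mem _ hb)))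
    · have : M.col b = ∑ a ∈ A, M a b • Pi.single a (1 : F) := by
        ext a
        simp only [Matrix.col_apply, Finset.sum_apply, Pi.smul_apply, Pi.single_apply, smul_eq_mul,
          mul_ite, mul_one, mul_zero, Finset.sum_ite_eq]
        split_ifs with ha
        · rfl
        · by_contra h0
          exact (h a b h0).elim ha hb
      rw [this]
      exact Submodule.sum_mem _ fun a ha => Submodule.smul_mem _ _
        (Submodule.subset_span (Finset.mem_coe.2 (Finset.mem_union_left _
          (Finset.mem_image_of_mem _ ha))))
  refine (Submodule.finrank_mono hS).trans ((finrank_span_finset_le_card S).trans ?_)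
  exact (Finset.card_union_le _ _).trans (add_le_add Finset.card_image_le Finset.card_image_le)

theorem Matrix.totalDegree_det_le {σ : Type*} {m : ℕ}
    (P : Matrix (Fin m) (Fin m) (MvPolynomial σ F)) (hP : ∀ i j, (P i j).totalDegree ≤ 1) :
    P.det.totalDegree ≤ m := by
  rw [Matrix.det_apply]
  refine MvPolynomial.totalDegree_finsetSum_le fun τ _ => ?_
  refine (MvPolynomial.totalDegree_smul_le _ _).trans ?_
  refine (MvPolynomial.totalDegree_finsetProd _ _).trans ?_
  refine (Finset.sum_le_card_nsmul _ _ 1 fun i _ => hP _ _).trans ?_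
  simp

/-- For a relation with a matching of size `m`, a matrix supported on the relation with independent
uniform entries from a finite set `S` has rank below `m` with probability at most `m / |S|`. -/
theorem card_rank_lt_le {R C : Type*} [Fintype R] [Fintype C] [DecidableEq F]
    (r : R → C → Prop) [∀ a b, Decidable (r a b)] {K : ℕ} (e : R × C ↪ Fin K) {m : ℕ}
    (f : Fin m → R) (g : Fin m → C) (hf : f.Injective) (hg : g.Injective)
    (hfg : ∀ i, r (f i) (g i)) (S : Finset F) :
    ((Fintype.piFinset fun _ : Fin K => S).filter fun w =>
      (Matrix.of fun a b => if r a b then w (e (a, b)) else 0).rank < m).card * S.card ≤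
      m * S.card ^ K := by
  classical
  set P : Matrix (Fin m) (Fin m) (MvPolynomial (Fin K) F) := Matrix.of fun i j =>
    if r (f i) (g j) then MvPolynomial.X (e (f i, g j)) else 0 with hP
  have heval : ∀ w : Fin K → F, MvPolynomial.eval w P.det =
      ((Matrix.of fun a b => if r a b then w (e (a, b)) else 0).submatrix f g).det := by
    intro w
    rw [RingHom.map_det]
    congr 1
    ext i j
    simp only [hP, RingHom.mapMatrix_apply, Matrix.map_apply, Matrix.of_apply,
      Matrix.submatrix_apply]
    split_ifs <;> simp
  have hne : P.det ≠ 0 := by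
    intro h0
    -- At the indicator of the matching the submatrix is the identity, so its determinant is a
    -- nonzero polynomial.
    have := heval fun v => if ∃ i, v = e (f i, g i) then 1 else 0
    rw [h0, map_zero] at this
    refine one_ne_zero (α := F) ?_
    rw [this]
    refine (Matrix.det_one (n := Fin m)).symm.trans (congr_arg Matrix.det ?_)
    ext i j
    simp only [Matrix.submatrix_apply, Matrix.of_apply, EmbeddingLike.apply_eq_iff_eq,
      Prod.mk.injEq, Matrix.one_apply]
    by_cases hij : i = j
    · subst hij
      rw [if_pos rfl, if_pos (hfg i), if_pos ⟨i, rfl, rfl⟩]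
    · rw [if_neg hij]
      split_ifs with h1 h2
      · obtain ⟨l, h3, h4⟩ := h2
        exact absurd ((hf h3).trans (hg h4).symm) hij
      · rfl
      · rfl
  have hdeg : P.det.totalDegree ≤ m := Matrix.totalDegree_det_le P fun i j => by
    simp only [hP, Matrix.of_apply]
    split_ifs
    · rw [MvPolynomial.totalDegree_X]
    · simp
  have hsz := MvPolynomial.schwartz_zippel_totalDegree hne S
  have hsub : ((Fintype.piFinset fun _ : Fin K => S).filter fun w =>
      (Matrix.of fun a b => if r a b then w (e (a, b)) else 0).rank < m) ⊆
      (Fintype.piFinset fun _ : Fin K => S).filter fun w => MvPolynomial.eval w P.det = 0 := by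
    refine Finset.monotone_filter_right _ fun w _ hw => ?_
    by_contra hdet
    rw [heval] at hdet
    have h1 := Matrix.rank_of_det_ne_zero hdet
    rw [Fintype.card_fin] at h1
    have h2 := Matrix.rank_submatrix_le
      (Matrix.of fun a b => if r a b then w (e (a, b)) else 0) f g
    omega
  refine (Nat.mul_le_mul_right _ (Finset.card_le_card hsub)).trans ?_
  rcases S.eq_empty_or_nonempty with rfl | hS
  · simp
  have hS' : (0 : ℚ≥0) < S.card := by exact_mod_cast hS.card_pos
  rw [div_le_div_iff₀ (pow_pos hS' _) hS'] at hsz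
  have h2 : ((P.det.totalDegree : ℕ) : ℚ≥0) * S.card ^ K ≤ m * S.card ^ K := by gcongr
  exact_mod_cast hsz.trans h2

end LinearAlgebra

/-! ### Primitive recursive tools: bounded search and kernel counting -/

section Computability

variable {α β : Type*} [Primcodable α] [Primcodable β]

theorem Primrec.nat_pow : Primrec₂ ((· ^ ·) : ℕ → ℕ → ℕ) :=
  Primrec₂.unpaired'.1 Nat.Primrec.pow

theorem Primrec.sum_range {b : α → ℕ} {f : α → ℕ → ℕ} (hb : Primrec b) (hf : Primrec₂ f) :
    Primrec fun a => ∑ i ∈ Finset.range (b a), f a i := by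
  refine (Primrec.nat_rec' hb (Primrec.const 0) (h := fun a x => x.2 + f a x.1) ?_).of_eq ?_
  · exact Primrec.nat_add.comp (Primrec.snd.comp Primrec.snd)
      (hf.comp Primrec.fst (Primrec.fst.comp Primrec.snd))
  · intro a
    induction b a with
    | zero => rfl
    | succ m ih => rw [Finset.sum_range_succ, ← ih]

theorem PrimrecPred.forall_mem {l : α → List β} {P : α → β → Prop} (hl : Primrec l)
    (hP : PrimrecRel P) : PrimrecPred fun a => ∀ x ∈ l a, P a x :=
  (PrimrecRel.forall_mem_list (R := fun x a => P a x) (hP.comp Primrec.snd Primrec.fst)).comp hl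
    Primrec.id

theorem PrimrecPred.forall_lt_of {b : α → ℕ} {P : α → ℕ → Prop} (hb : Primrec b)
    (hP : PrimrecRel P) : PrimrecPred fun a => ∀ i < b a, P a i :=
  (PrimrecPred.forall_mem (Primrec.list_range.comp hb) hP).of_eq (by simp)

theorem PrimrecPred.exists_lt_of {b : α → ℕ} {P : α → ℕ → Prop} (hb : Primrec b)
    (hP : PrimrecRel P) : PrimrecPred fun a => ∃ i < b a, P a i :=
  ((PrimrecRel.exists_mem_list (R := fun x a => P a x) (hP.comp Primrec.snd Primrec.fst)).comp
    (Primrec.list_range.comp hb) Primrec.id).of_eq (by simp)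

open Classical in
/-- The least number below `b` that satisfies `P`, and `b` if there is none. -/
noncomputable def boundedSearch (b : ℕ) (P : ℕ → Prop) : ℕ :=
  (List.range b).findIdx fun i => decide (P i)

theorem boundedSearch_spec {b : ℕ} {P : ℕ → Prop} (h : ∃ i < b, P i) :
    boundedSearch b P < b ∧ P (boundedSearch b P) := by
  classical
  obtain ⟨i, hi, hP⟩ := h
  have h1 : (List.range b).findIdx (fun i => decide (P i)) < (List.range b).length :=
    List.findIdx_lt_length_of_exists ⟨i, by simpa using hi, by simpa using hP⟩
  have h2 := List.findIdx_getElem (w := h1)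
  rw [List.getElem_range, decide_eq_true_eq] at h2
  exact ⟨by simpa [boundedSearch] using h1, h2⟩

theorem not_of_lt_boundedSearch {b : ℕ} {P : ℕ → Prop} {i : ℕ} (h : i < boundedSearch b P) :
    ¬ P i := by
  classical
  have := List.not_of_lt_findIdx (p := fun i => decide (P i)) (xs := List.range b) h
  simpa using this

theorem Primrec.boundedSearch {b : α → ℕ} {P : α → ℕ → Prop} (hb : Primrec b)
    (hP : PrimrecRel P) : Primrec fun a => boundedSearch (b a) (P a) := by
  classical
  exact Primrec.list_findIdx (Primrec.list_range.comp hb) hP.decide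

theorem PrimrecPred.nat_prime : PrimrecPred Nat.Prime := by
  refine (PrimrecPred.and (Primrec.nat_le.comp (Primrec.const 2) Primrec.id)
    (PrimrecPred.forall_lt_of (P := fun p m => ¬ p % m = 0 ∨ m = 1) Primrec.id ?_)).of_eq ?_
  · exact PrimrecPred.or (PrimrecPred.not (Primrec.eq.comp Primrec.nat_mod (Primrec.const 0)))
      (Primrec.eq.comp Primrec.snd (Primrec.const 1))
  · intro p
    rw [Nat.prime_def_lt]
    simp only [Nat.dvd_iff_mod_eq_zero, imp_iff_not_or, id]

/-- The number of vectors, over the integers modulo `p`, in the kernel of a matrix with `r` rows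
and `c` columns. -/
def kerCount (p r c : ℕ) (f : ℕ → ℕ → ℕ) : ℕ :=
  ∑ z ∈ Finset.range (p ^ c),
    if ∀ i < r, (∑ j ∈ Finset.range c, f i j * (z / p ^ j % p)) % p = 0 then 1 else 0

/-- The base-`p` digits of the numbers below `p ^ c` run through all vectors. Counting kernel
vectors encodes the nullity with no need for elimination. -/
theorem kerCount_eq_pow (p r c : ℕ) [Fact p.Prime] (f : ℕ → ℕ → ℕ) :
    kerCount p r c f = p ^ Module.finrank (ZMod p) (LinearMap.ker
      (Matrix.of fun (i : Fin r) (j : Fin c) => (f i j : ZMod p)).mulVecLin) := by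
  have hcard := Module.natCard_eq_pow_finrank (K := ZMod p) (V := LinearMap.ker
      (Matrix.of fun (i : Fin r) (j : Fin c) => (f i j : ZMod p)).mulVecLin)
  rw [Nat.card_zmod] at hcard
  rw [← hcard, kerCount, ← Finset.card_filter, Finset.card_filter, Finset.sum_range,
    ← Finset.card_filter, ← Fintype.card_subtype, ← Nat.card_eq_fintype_card]
  set ψ : Fin p → ZMod p := fun x => ((x : ℕ) : ZMod p) with hψ
  have hψb : Function.Bijective ψ := by
    rw [Fintype.bijective_iff_injective_and_card]
    refine ⟨fun x y h => ?_, by simp⟩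
    have := (ZMod.natCast_eq_natCast_iff' _ _ _).1 h
    rw [Nat.mod_eq_of_lt x.2, Nat.mod_eq_of_lt y.2] at this
    exact Fin.ext this
  set Φ : Fin (p ^ c) ≃ (Fin c → ZMod p) := finFunctionFinEquiv.symm.trans
    (Equiv.arrowCongr (Equiv.refl _) (Equiv.ofBijective ψ hψb)) with hΦ
  refine Nat.card_congr (Φ.subtypeEquiv fun z => ?_)
  have hz : ∀ j : Fin c, Φ z j = ((z / p ^ (j : ℕ) % p : ℕ) : ZMod p) := by
    intro j
    rfl
  rw [LinearMap.mem_ker, Matrix.mulVecLin_apply, funext_iff, Fin.forall_iff]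
  refine forall₂_congr fun i hi => ?_
  rw [← Nat.dvd_iff_mod_eq_zero, ← ZMod.natCast_eq_zero_iff]
  simp only [Matrix.mulVec, dotProduct, Matrix.of_apply, hz, Pi.zero_apply]
  rw [Finset.sum_range]
  push_cast
  rfl

theorem Primrec.kerCount {p r c : α → ℕ} {f : α → ℕ → ℕ → ℕ} (hp : Primrec p) (hr : Primrec r)
    (hc : Primrec c) (hf : Primrec fun x : (α × ℕ) × ℕ => f x.1.1 x.1.2 x.2) :
    Primrec fun a => kerCount (p a) (r a) (c a) (f a) := by
  have hdig : Primrec fun x : ((α × ℕ) × ℕ) × ℕ => x.1.1.2 / p x.1.1.1 ^ x.2 % p x.1.1.1 :=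
    Primrec.nat_mod.comp (Primrec.nat_div.comp (snd.comp (fst.comp fst))
      (Primrec.nat_pow.comp (hp.comp (fst.comp (fst.comp fst))) snd))
      (hp.comp (fst.comp (fst.comp fst)))
  have hf' : Primrec fun x : ((α × ℕ) × ℕ) × ℕ => f x.1.1.1 x.1.2 x.2 :=
    hf.comp (Primrec.pair (Primrec.pair (fst.comp (fst.comp fst)) (snd.comp fst)) snd)
  refine Primrec.sum_range (Primrec.nat_pow.comp hp hc)
    (Primrec.ite (PrimrecPred.forall_lt_of (α := α × ℕ) (b := fun x => r x.1)
      (P := fun x i => (∑ j ∈ Finset.range (c x.1), f x.1 i j * (x.2 / p x.1 ^ j % p x.1)) % p x.1 = 0)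
      (hr.comp fst) ?_) (Primrec.const 1) (Primrec.const 0))
  refine Primrec.eq.comp (Primrec.nat_mod.comp (Primrec.sum_range (hc.comp (fst.comp fst)) ?_)
    (hp.comp (fst.comp fst))) (Primrec.const 0)
  exact Primrec.nat_mul.comp hf' hdig

end Computability

/-! ### Parameters and algorithms of the sketching scheme -/

section Scheme

/-- The exponent of the least power of two that is at least `n`. -/
noncomputable def ceilLog (n : ℕ) : ℕ := boundedSearch n fun e => n ≤ 2 ^ e

/-- By minimality of the exponent the power is below 2n, hence at most n². -/
theorem le_two_pow_ceilLog {n : ℕ} (hn : 2 ≤ n) : n ≤ 2 ^ ceilLog n ∧ 2 ^ ceilLog n ≤ n ^ 2 := by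
  have h := boundedSearch_spec (b := n) (P := fun e => n ≤ 2 ^ e) ⟨n - 1, by omega, by
    have := Nat.lt_two_pow_self (n := n - 1)
    omega⟩
  refine ⟨h.2, ?_⟩
  rw [ceilLog]
  rcases hE : boundedSearch n fun e => n ≤ 2 ^ e with - | e
  · rw [hE] at h
    simp at h
    omega
  · have := not_of_lt_boundedSearch (b := n) (P := fun e => n ≤ 2 ^ e) (i := e) (by omega)
    rw [pow_succ]
    nlinarith

/-- The number of coins used for one random weight. -/
noncomputable def weightBits (d n : ℕ) : ℕ := 2 * ceilLog n + 2 + d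

/-- The modulus of the computations: a prime between `2 ^ b` and `2 * 2 ^ b`. -/
noncomputable def modulus (d n : ℕ) : ℕ :=
  2 ^ weightBits d n + 1 + boundedSearch (2 ^ weightBits d n) fun i =>
    (2 ^ weightBits d n + 1 + i).Prime

theorem modulus_spec (d n : ℕ) : (modulus d n).Prime ∧ 2 ^ weightBits d n < modulus d n ∧
    modulus d n ≤ 2 * 2 ^ weightBits d n := by
  obtain ⟨p, hp, h1, h2⟩ := Nat.exists_prime_lt_and_le_two_mul (2 ^ weightBits d n) (by positivity)
  have := boundedSearch_spec (b := 2 ^ weightBits d n)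
    (P := fun i => (2 ^ weightBits d n + 1 + i).Prime) ⟨p - (2 ^ weightBits d n + 1), by omega, by
      rwa [show 2 ^ weightBits d n + 1 + (p - (2 ^ weightBits d n + 1)) = p by omega]⟩
  refine ⟨this.2, ?_, ?_⟩ <;> rw [modulus] <;> omega

theorem two_pow_weightBits (d n : ℕ) :
    2 ^ weightBits d n = 4 * 2 ^ d * (2 ^ ceilLog n) ^ 2 := by
  rw [weightBits]
  ring

theorem modulus_le_pow (d : ℕ) {n : ℕ} (hn : 2 ≤ n) : modulus d n ≤ n ^ (7 + d) := by
  refine (modulus_spec d n).2.2.trans ?_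
  rw [two_pow_weightBits]
  have h1 := (le_two_pow_ceilLog hn).2
  have h2 : 2 ^ d ≤ n ^ d := Nat.pow_le_pow_left hn d
  have h3 : 2 ^ 3 ≤ n ^ 3 := Nat.pow_le_pow_left hn 3
  calc 2 * (4 * 2 ^ d * (2 ^ ceilLog n) ^ 2) = 2 ^ 3 * 2 ^ d * (2 ^ ceilLog n) ^ 2 := by ring
    _ ≤ n ^ 3 * n ^ d * (n ^ 2) ^ 2 := by gcongr
    _ = n ^ (7 + d) := by ring

/-- The input of the compression algorithm. -/
abbrev Input : Type := List (List Bool) × (ℕ × ℕ) × List ℕ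

/-- The number of vertices of an input. -/
def Input.size (a : Input) : ℕ := a.1.length

def Input.Adj (a : Input) (u v : ℕ) : Prop := (a.1.getD u []).getD v false = true

/-- A query as a Boolean function on pairs of numbers. -/
def Query.bit {k : ℕ} (Q : Query k) (i j : ℕ) : Bool :=
  ((List.ofFn fun i => List.ofFn (Q i)).getD i []).getD j false

def Input.queryRel {k : ℕ} (a : Input) (Q : Query k) (u v : ℕ) : Prop :=
  ∃ x < k * k, Q.bit (x / k) (x % k) = true ∧ a.2.2.getD (x / k) 0 = u ∧ a.2.2.getD (x % k) 0 = v

/-- The random weight with number `m` given by the outcomes `l` of the coins. -/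
def weight (b : ℕ) (l : List Bool) (m : ℕ) : ℕ :=
  ∑ t ∈ Finset.range b, (if l.getD (t + b * m) false = true then 1 else 0) * 2 ^ t

/-- The pair of vertices that belongs to a row or column. -/
def vertexPair (n i : ℕ) : ℕ × ℕ := (i % (n * n) / n, i % (n * n) % n)

open Classical in
/-- The entries of the matrix with random weights supported on `cutRel`. -/
noncomputable def cutMatrix {k : ℕ} (d : ℕ) (a : Input) (l : List Bool) (Q : Query k)
    (i j : ℕ) : ℕ :=
  if cutRel a.Adj (a.queryRel Q) a.2.1.1 a.2.1.2 (i / (a.size * a.size)) (vertexPair a.size i)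
      (j / (a.size * a.size)) (vertexPair a.size j) then
    weight (weightBits d a.size) l (j + 4 * (a.size * a.size) * i) else 0

/-- The entries of the small matrix that is encoded, in base `p`, by the number `X`. -/
def smallMatrix {k : ℕ} (p X : ℕ) (Q : Query k) (i j : ℕ) : ℕ :=
  X / p ^ (1 + (j + k * k * i)) % p + X / p ^ (1 + 2 * (k * k) * (k * k) + (j + k * k * i)) % p *
    (if Q.bit (j / k) (j % k) = true then 1 else 0)

/-- The number `X` encodes the answers to all queries. -/
def IsSketchNumber (k d : ℕ) (a : Input) (l : List Bool) (X : ℕ) : Prop :=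
  ∀ Q ∈ (Finset.univ : Finset (Query k)).toList,
    kerCount (modulus d a.size) (4 * (a.size * a.size)) (4 * (a.size * a.size))
        (cutMatrix d a l Q) =
      modulus d a.size ^ (X % modulus d a.size) *
        kerCount (modulus d a.size) (2 * (k * k)) (k * k) (smallMatrix (modulus d a.size) X Q)

/-- The number of base-`p` digits of the number encoded by a sketch. -/
def sketchDigits (k : ℕ) : ℕ := 1 + 4 * (k * k) * (k * k)

/-- The small matrices are not computed: any number that reproduces the nullities for all queries
serves equally well. -/
noncomputable def sketchNumber (k d : ℕ) (a : Input) (l : List Bool) : ℕ :=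
  boundedSearch (modulus d a.size ^ sketchDigits k) (IsSketchNumber k d a l)

/-- The number of vertices, followed by base-n digits. Since p ≤ n^(7 + d), each base-p digit costs
at most 7 + d words. -/
noncomputable def sketch (k d : ℕ) (a : Input) (l : List Bool) : List ℕ :=
  a.size :: (List.range ((7 + d) * sketchDigits k)).map fun i =>
    sketchNumber k d a l / a.size ^ i % a.size

/-- The number encoded by a sketch. -/
def decodeSketch (k d : ℕ) (Γ : List ℕ) : ℕ :=
  ∑ i ∈ Finset.range ((7 + d) * sketchDigits k), Γ.getD (i + 1) 0 * Γ.getD 0 0 ^ i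

/-- Solves n² - λ = κ + ν for λ, where κ is the lowest base-p digit of `X` and the small matrix has
nullity ν. The sum is a logarithm: it counts the exponents 1, ..., k² that are at most ν. -/
noncomputable def answerFromNumber {k : ℕ} (d n X : ℕ) (Q : Query k) : ℕ :=
  n * n - X % modulus d n - ∑ r ∈ Finset.range (k * k),
    if modulus d n ^ (r + 1) ≤
      kerCount (modulus d n) (2 * (k * k)) (k * k) (smallMatrix (modulus d n) X Q) then 1 else 0

noncomputable def answerFromSketch {k : ℕ} (d : ℕ) (x : Query k × List ℕ) : ℕ :=
  answerFromNumber d (x.2.getD 0 0) (decodeSketch k d x.2) x.1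

noncomputable def coinCount (d : ℕ) (a : Input) : ℕ :=
  4 * (a.size * a.size) * (4 * (a.size * a.size)) * weightBits d a.size

end Scheme

/-! ### The algorithms are primitive recursive -/

section SchemeComputability

open Primrec

theorem primrec_ceilLog : Primrec ceilLog :=
  Primrec.boundedSearch Primrec.id
    (Primrec.nat_le.comp fst (Primrec.nat_pow.comp (Primrec.const 2) snd))

theorem primrec_weightBits (d : ℕ) : Primrec (weightBits d) :=
  Primrec.nat_add.comp (Primrec.nat_add.comp (Primrec.nat_mul.comp (Primrec.const 2)
    primrec_ceilLog) (Primrec.const 2)) (Primrec.const d)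

theorem primrec_modulus (d : ℕ) : Primrec (modulus d) := by
  have h : Primrec fun n => 2 ^ weightBits d n :=
    Primrec.nat_pow.comp (Primrec.const 2) (primrec_weightBits d)
  have h1 : Primrec fun n => 2 ^ weightBits d n + 1 := Primrec.succ.comp h
  exact Primrec.nat_add.comp h1 (Primrec.boundedSearch h
    (PrimrecPred.nat_prime.comp (Primrec.nat_add.comp (h1.comp fst) snd)))

theorem primrec_size : Primrec Input.size := Primrec.list_length.comp fst

theorem primrec_bit (k : ℕ) : Primrec fun x : (Query k × ℕ) × ℕ => x.1.1.bit x.1.2 x.2 := by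
  have h : Primrec fun Q : Query k => List.ofFn fun i => List.ofFn (Q i) :=
    Primrec.list_ofFn fun i => Primrec.list_ofFn fun j =>
      Primrec.fin_app.comp (Primrec.fin_app.comp Primrec.id (Primrec.const i)) (Primrec.const j)
  exact (Primrec.list_getD false).comp
    ((Primrec.list_getD []).comp (h.comp (fst.comp fst)) (snd.comp fst)) snd

theorem primrecPred_adj : PrimrecPred fun x : (Input × ℕ) × ℕ => x.1.1.Adj x.1.2 x.2 :=
  Primrec.eq.comp ((Primrec.list_getD false).comp
    ((Primrec.list_getD []).comp (fst.comp (fst.comp fst)) (snd.comp fst)) snd) (Primrec.const true)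

theorem primrecPred_queryRel {α : Type*} [Primcodable α] {k : ℕ} {a : α → Input}
    {Q : α → Query k} {u v : α → ℕ} (ha : Primrec a) (hQ : Primrec Q) (hu : Primrec u)
    (hv : Primrec v) : PrimrecPred fun x => (a x).queryRel (Q x) (u x) (v x) := by
  have hd : Primrec fun x : α × ℕ => x.2 / k := Primrec.nat_div.comp snd (Primrec.const k)
  have hm : Primrec fun x : α × ℕ => x.2 % k := Primrec.nat_mod.comp snd (Primrec.const k)
  have hT : Primrec fun x : α × ℕ => (a x.1).2.2 := snd.comp (snd.comp (ha.comp fst))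
  have h1 : PrimrecPred fun x : α × ℕ => (Q x.1).bit (x.2 / k) (x.2 % k) = true :=
    Primrec.eq.comp ((primrec_bit k).comp (Primrec.pair (Primrec.pair (hQ.comp fst) hd) hm))
      (Primrec.const true)
  have h2 : PrimrecPred fun x : α × ℕ => (a x.1).2.2.getD (x.2 / k) 0 = u x.1 :=
    Primrec.eq.comp ((Primrec.list_getD 0).comp hT hd) (hu.comp fst)
  have h3 : PrimrecPred fun x : α × ℕ => (a x.1).2.2.getD (x.2 % k) 0 = v x.1 :=
    Primrec.eq.comp ((Primrec.list_getD 0).comp hT hm) (hv.comp fst)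
  have h4 : PrimrecRel fun (x : α) (i : ℕ) => (Q x).bit (i / k) (i % k) = true ∧
    (a x).2.2.getD (i / k) 0 = u x ∧ (a x).2.2.getD (i % k) 0 = v x := h1.and (h2.and h3)
  exact PrimrecPred.exists_lt_of (Primrec.const (k * k)) h4

theorem primrec_weight {α : Type*} [Primcodable α] {b m : α → ℕ} {l : α → List Bool}
    (hb : Primrec b) (hl : Primrec l) (hm : Primrec m) :
    Primrec fun x => weight (b x) (l x) (m x) := by
  refine Primrec.sum_range hb (Primrec.nat_mul.comp (Primrec.ite (Primrec.eq.comp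
    ((Primrec.list_getD false).comp (hl.comp fst) ?_) (Primrec.const true)) (Primrec.const 1)
      (Primrec.const 0)) (Primrec.nat_pow.comp (Primrec.const 2) snd))
  exact Primrec.nat_add.comp snd (Primrec.nat_mul.comp (hb.comp fst) (hm.comp fst))

theorem primrec_vertexPair {α : Type*} [Primcodable α] {n i : α → ℕ} (hn : Primrec n)
    (hi : Primrec i) : Primrec fun x => vertexPair (n x) (i x) :=
  have h : Primrec fun x => i x % (n x * n x) := Primrec.nat_mod.comp hi (Primrec.nat_mul.comp hn hn)
  Primrec.pair (Primrec.nat_div.comp h hn) (Primrec.nat_mod.comp h hn)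

theorem primrecPred_cutRel {α : Type*} [Primcodable α] {A B : α → ℕ → ℕ → Prop}
    {s t c c' : α → ℕ} {p p' : α → ℕ × ℕ}
    (hA : PrimrecPred fun x => A x (p' x).1 (p' x).2)
    (hB : PrimrecPred fun x => B x (p x).1 (p x).2)
    (hs : Primrec s) (ht : Primrec t) (hc : Primrec c) (hc' : Primrec c') (hp : Primrec p)
    (hp' : Primrec p') :
    PrimrecPred fun x => cutRel (A x) (B x) (s x) (t x) (c x) (p x) (c' x) (p' x) := by
  have e : ∀ {f : α → ℕ} (_ : Primrec f) (m : ℕ), PrimrecPred fun x => f x = m :=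
    fun hf m => Primrec.eq.comp hf (Primrec.const m)
  have hpp : PrimrecPred fun x => p x = p' x := Primrec.eq.comp hp hp'
  have h02 := (e hc 0).or (e hc 2)
  exact ((Primrec.eq.comp hc hc').and ((e hc 3).not.and hpp)).or
    (((((e hc' 0).and hA).or ((e hc' 1).and hA.not)).and
      ((h02.and (Primrec.eq.comp (snd.comp hp) (fst.comp hp'))).or
        ((e hc 3).and (hpp.and (Primrec.eq.comp (fst.comp hp) hs))))).or
    ((h02.and ((e hc' 3).and (hpp.and (Primrec.eq.comp (snd.comp hp) ht)))).or
    ((e hc 1).and ((e hc' 2).and (hpp.and hB)))))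

theorem primrec_cutMatrix {α : Type*} [Primcodable α] {k : ℕ} (d : ℕ) {a : α → Input}
    {l : α → List Bool} {Q : α → Query k} {i j : α → ℕ} (ha : Primrec a) (hl : Primrec l)
    (hQ : Primrec Q) (hi : Primrec i) (hj : Primrec j) :
    Primrec fun x => cutMatrix d (a x) (l x) (Q x) (i x) (j x) := by
  classical
  have hn := primrec_size.comp ha
  have hnn := Primrec.nat_mul.comp hn hn
  have hpi := primrec_vertexPair hn hi
  have hpj := primrec_vertexPair hn hj
  refine Primrec.ite (primrecPred_cutRel
    (A := fun x => (a x).Adj) (B := fun x => (a x).queryRel (Q x)) ?_ ?_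
    (fst.comp (fst.comp (snd.comp ha))) (snd.comp (fst.comp (snd.comp ha)))
    (Primrec.nat_div.comp hi hnn) (Primrec.nat_div.comp hj hnn) hpi hpj) ?_ (Primrec.const 0)
  · exact primrecPred_adj.comp (Primrec.pair (Primrec.pair ha (fst.comp hpj)) (snd.comp hpj))
  · exact primrecPred_queryRel ha hQ (fst.comp hpi) (snd.comp hpi)
  · exact primrec_weight ((primrec_weightBits d).comp hn) hl (Primrec.nat_add.comp hj
      (Primrec.nat_mul.comp (Primrec.nat_mul.comp (Primrec.const 4) hnn) hi))

theorem primrec_smallMatrix {α : Type*} [Primcodable α] {k : ℕ} {p X i j : α → ℕ}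
    {Q : α → Query k} (hp : Primrec p) (hX : Primrec X) (hQ : Primrec Q) (hi : Primrec i)
    (hj : Primrec j) : Primrec fun x => smallMatrix (p x) (X x) (Q x) (i x) (j x) := by
  have hdig : ∀ {f : α → ℕ} (_ : Primrec f), Primrec fun x => X x / p x ^ f x % p x := fun hf =>
    Primrec.nat_mod.comp (Primrec.nat_div.comp hX (Primrec.nat_pow.comp hp hf)) hp
  have hij : Primrec fun x => j x + k * k * i x :=
    Primrec.nat_add.comp hj (Primrec.nat_mul.comp (Primrec.const _) hi)
  exact Primrec.nat_add.comp (hdig (Primrec.nat_add.comp (Primrec.const 1) hij))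
    (Primrec.nat_mul.comp (hdig (Primrec.nat_add.comp (Primrec.const _) hij))
      (Primrec.ite (Primrec.eq.comp ((primrec_bit k).comp (Primrec.pair (Primrec.pair hQ
        (Primrec.nat_div.comp hj (Primrec.const k))) (Primrec.nat_mod.comp hj (Primrec.const k))))
        (Primrec.const true)) (Primrec.const 1) (Primrec.const 0)))

theorem primrec_kerCount_smallMatrix {α : Type*} [Primcodable α] {k : ℕ} {p X : α → ℕ}
    {Q : α → Query k} (hp : Primrec p) (hX : Primrec X) (hQ : Primrec Q) :
    Primrec fun x => kerCount (p x) (2 * (k * k)) (k * k) (smallMatrix (p x) (X x) (Q x)) :=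
  Primrec.kerCount hp (Primrec.const _) (Primrec.const _)
    (primrec_smallMatrix (hp.comp (fst.comp fst)) (hX.comp (fst.comp fst)) (hQ.comp (fst.comp fst))
      (snd.comp fst) snd)

theorem primrecRel_isSketchNumber (k d : ℕ) :
    PrimrecRel fun (x : Input × List Bool) X => IsSketchNumber k d x.1 x.2 X := by
  have hx : Primrec fun x : ((Input × List Bool) × ℕ) × Query k => x.1.1 := fst.comp fst
  have hX : Primrec fun x : ((Input × List Bool) × ℕ) × Query k => x.1.2 := snd.comp fst
  have hQ : Primrec fun x : ((Input × List Bool) × ℕ) × Query k => x.2 := snd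
  have hn := primrec_size.comp (fst.comp hx)
  have hp := (primrec_modulus d).comp hn
  have hN := Primrec.nat_mul.comp (Primrec.const 4) (Primrec.nat_mul.comp hn hn)
  have hM : Primrec fun x : (((((Input × List Bool) × ℕ) × Query k)) × ℕ) × ℕ =>
      cutMatrix d x.1.1.1.1.1 x.1.1.1.1.2 x.1.1.2 x.1.2 x.2 :=
    primrec_cutMatrix d (fst.comp (hx.comp (fst.comp fst))) (snd.comp (hx.comp (fst.comp fst)))
      (hQ.comp (fst.comp fst)) (snd.comp fst) snd
  have h1 := Primrec.kerCount (f := fun x : ((Input × List Bool) × ℕ) × Query k =>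
    cutMatrix d x.1.1.1 x.1.1.2 x.2) hp hN hN hM
  have h2 := Primrec.nat_mul.comp (Primrec.nat_pow.comp hp (Primrec.nat_mod.comp hX hp))
    (primrec_kerCount_smallMatrix hp hX hQ)
  have h3 : PrimrecRel fun (x : (Input × List Bool) × ℕ) (Q : Query k) =>
      kerCount (modulus d x.1.1.size) (4 * (x.1.1.size * x.1.1.size))
        (4 * (x.1.1.size * x.1.1.size)) (cutMatrix d x.1.1 x.1.2 Q) =
      modulus d x.1.1.size ^ (x.2 % modulus d x.1.1.size) *
        kerCount (modulus d x.1.1.size) (2 * (k * k)) (k * k)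
          (smallMatrix (modulus d x.1.1.size) x.2 Q) := Primrec.eq.comp h1 h2
  exact (PrimrecPred.forall_mem (Primrec.const (Finset.univ : Finset (Query k)).toList) h3).of_eq
    fun _ => Iff.rfl

theorem primrec_sketchNumber (k d : ℕ) :
    Primrec fun x : Input × List Bool => sketchNumber k d x.1 x.2 :=
  Primrec.boundedSearch (Primrec.nat_pow.comp ((primrec_modulus d).comp (primrec_size.comp fst))
    (Primrec.const _)) (primrecRel_isSketchNumber k d)

theorem primrec_sketch (k d : ℕ) : Primrec₂ (sketch k d) := by
  refine Primrec.list_cons.comp (primrec_size.comp fst) (Primrec.list_map (Primrec.const _) ?_)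
  have hn : Primrec fun x : (Input × List Bool) × ℕ => x.1.1.size :=
    primrec_size.comp (fst.comp fst)
  exact Primrec.nat_mod.comp (Primrec.nat_div.comp ((primrec_sketchNumber k d).comp fst)
    (Primrec.nat_pow.comp hn snd)) hn

theorem primrec_answerFromSketch (k d : ℕ) :
    Primrec fun x : Query k × List ℕ => answerFromSketch d x := by
  have hn : Primrec fun x : Query k × List ℕ => x.2.getD 0 0 :=
    (Primrec.list_getD 0).comp snd (Primrec.const 0)
  have hX : Primrec fun x : Query k × List ℕ => decodeSketch k d x.2 := by
    refine Primrec.sum_range (Primrec.const _) (Primrec.nat_mul.comp ((Primrec.list_getD 0).comp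
      (snd.comp fst) (Primrec.succ.comp snd)) (Primrec.nat_pow.comp (hn.comp fst) snd))
  have hp := (primrec_modulus d).comp hn
  refine Primrec.nat_sub.comp (Primrec.nat_sub.comp (Primrec.nat_mul.comp hn hn)
    (Primrec.nat_mod.comp hX hp)) (Primrec.sum_range (Primrec.const _) ?_)
  exact Primrec.ite (Primrec.nat_le.comp (Primrec.nat_pow.comp (hp.comp fst)
    (Primrec.succ.comp snd)) ((primrec_kerCount_smallMatrix hp hX fst).comp fst))
    (Primrec.const 1) (Primrec.const 0)

theorem primrec_coinCount (d : ℕ) : Primrec (coinCount d) := by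
  have hN := Primrec.nat_mul.comp (Primrec.const 4) (Primrec.nat_mul.comp primrec_size primrec_size)
  exact Primrec.nat_mul.comp (Primrec.nat_mul.comp hN hN)
    ((primrec_weightBits d).comp primrec_size)

/-- The sketching scheme with failure probability `2 ^ (-d)`. -/
noncomputable def sketchingScheme (k d : ℕ) : STSketchingScheme k where
  compress :=
    { coins := coinCount d
      run := sketch k d
      computable_coins := (primrec_coinCount d).to_comp
      computable_run := (primrec_sketch k d).to_comp }
  extract :=
    { coins := fun _ => 0
      run := fun x _ => answerFromSketch d x
      computable_coins := Computable.const 0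
      computable_run := ((primrec_answerFromSketch k d).comp fst).to_comp }

end SchemeComputability

/-! ### Encoded instances and their weighted matrices -/

theorem STInstance.two_le {k n : ℕ} (I : STInstance k n) : 2 ≤ n := by
  have h1 := I.s.2
  have h2 := I.t.2
  have h3 : (I.s : ℕ) ≠ I.t := fun h => I.s_ne_t (Fin.ext h)
  omega

theorem List.getD_ofFn {α : Type*} {n : ℕ} (f : Fin n → α) (i : Fin n) (x : α) :
    (List.ofFn f).getD i x = f i := by
  rw [List.getD_eq_getElem _ _ (by simp)]
  simp

theorem Query.bit_val {k : ℕ} (Q : Query k) (i j : Fin k) : Q.bit i j = Q i j := by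
  rw [Query.bit, List.getD_ofFn, List.getD_ofFn]

/-- The decoding of a row or column number into a kind and a pair of vertices. -/
def labelEquiv (n : ℕ) : Fin (4 * (n * n)) ≃ Fin 4 × Fin n × Fin n :=
  finProdFinEquiv.symm.trans (Equiv.prodCongr (Equiv.refl _) finProdFinEquiv.symm)

theorem labelEquiv_fst (n : ℕ) (i : Fin (4 * (n * n))) :
    ((labelEquiv n i).1 : ℕ) = i / (n * n) := rfl

theorem vertexPair_eq (n : ℕ) (i : Fin (4 * (n * n))) :
    vertexPair n i = (((labelEquiv n i).2.1 : ℕ), ((labelEquiv n i).2.2 : ℕ)) := rfl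

namespace STInstance

variable {k n : ℕ} (I : STInstance k n)

theorem size_encoding : Input.size I.encoding = n := by
  simp [Input.size, encoding]

theorem adj_encoding (u v : Fin n) : Input.Adj I.encoding u v ↔ I.graph.Adj u v := by
  classical
  rw [Input.Adj, encoding]
  simp only
  rw [List.getD_ofFn, List.getD_ofFn, decide_eq_true_eq]

theorem getD_encoding (i : Fin k) : I.encoding.2.2.getD i 0 = I.terminal i := by
  rw [encoding]
  simp only
  rw [List.getD_ofFn]

theorem queryRel_encoding (Q : Query k) (u v : Fin n) :
    Input.queryRel I.encoding Q u v ↔ I.queryRel Q u v := by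
  constructor
  · rintro ⟨x, hx, hQ, hu, hv⟩
    have h1 := Q.bit_val (Fin.divNat ⟨x, hx⟩) (Fin.modNat ⟨x, hx⟩)
    have h2 := I.getD_encoding (Fin.divNat ⟨x, hx⟩)
    have h3 := I.getD_encoding (Fin.modNat ⟨x, hx⟩)
    simp only [Fin.coe_divNat, Fin.coe_modNat] at h1 h2 h3
    exact ⟨_, _, h1.symm.trans hQ, Fin.ext (h2.symm.trans hu), Fin.ext (h3.symm.trans hv)⟩
  · rintro ⟨i, j, hQ, rfl, rfl⟩
    have hx := finProdFinEquiv.symm_apply_apply (i, j)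
    set x := finProdFinEquiv (i, j)
    have h1 : i = x.divNat := (congr_arg Prod.fst hx).symm
    have h2 : j = x.modNat := (congr_arg Prod.snd hx).symm
    refine ⟨x, x.2, ?_, ?_, ?_⟩
    · rw [← Fin.coe_divNat, ← Fin.coe_modNat, ← h1, ← h2, Q.bit_val, hQ]
    · rw [← Fin.coe_divNat, ← h1, getD_encoding]
    · rw [← Fin.coe_modNat, ← h2, getD_encoding]

/-- The relation `cutRel` of the instance, between row numbers and column numbers. -/
def rel (Q : Query k) (i j : Fin (4 * (n * n))) : Prop :=
  cutRel I.graph.Adj (I.queryRel Q) I.s I.t (labelEquiv n i).1 (labelEquiv n i).2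
    (labelEquiv n j).1 (labelEquiv n j).2

theorem cutRel_encoding (Q : Query k) (i j : Fin (4 * (n * n))) :
    cutRel (Input.Adj I.encoding) (Input.queryRel I.encoding Q) I.encoding.2.1.1 I.encoding.2.1.2
      (i / (n * n)) (vertexPair n i) (j / (n * n)) (vertexPair n j) ↔ I.rel Q i j := by
  rw [vertexPair_eq, vertexPair_eq, ← labelEquiv_fst, ← labelEquiv_fst, rel]
  rcases labelEquiv n i with ⟨c, u, v⟩
  rcases labelEquiv n j with ⟨c', u', v'⟩
  have hs : I.encoding.2.1.1 = I.s := rfl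
  have ht : I.encoding.2.1.2 = I.t := rfl
  simp only [cutRel, adj_encoding, queryRel_encoding, hs, ht, Prod.mk.injEq, Fin.ext_iff]

/-- The random weights, as residues. -/
noncomputable def weights (n d : ℕ) (l : List Bool) (m : Fin (4 * (n * n) * (4 * (n * n)))) :
    ZMod (modulus d n) :=
  (weight (weightBits d n) l m : ℕ)

open Classical in
/-- The matrix with random weights supported on `rel`. -/
noncomputable def relMatrix (d : ℕ) (l : List Bool) (Q : Query k) :
    Matrix (Fin (4 * (n * n))) (Fin (4 * (n * n))) (ZMod (modulus d n)) :=
  Matrix.of fun i j => if I.rel Q i j then weights n d l (finProdFinEquiv (i, j)) else 0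

theorem cutMatrix_eq (d : ℕ) (l : List Bool) (Q : Query k) :
    (Matrix.of fun (i j : Fin (4 * (n * n))) =>
      (cutMatrix d I.encoding l Q i j : ZMod (modulus d n))) = I.relMatrix d l Q := by
  ext i j
  have h := I.cutRel_encoding Q i j
  rw [Matrix.of_apply, relMatrix, Matrix.of_apply, cutMatrix, size_encoding]
  by_cases hr : I.rel Q i j
  · rw [if_pos hr, if_pos (h.2 hr)]
    rfl
  · rw [if_neg hr, if_neg fun h' => hr (h.1 h'), Nat.cast_zero]

theorem rel_matching (Q : Query k) :
    (∃ A B : Finset (Fin (4 * (n * n))), (∀ a b, I.rel Q a b → a ∈ A ∨ b ∈ B) ∧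
      A.card + B.card = 3 * n ^ 2 + I.answer Q) ∧
    ∃ f g : Fin (3 * n ^ 2 + I.answer Q) → Fin (4 * (n * n)), f.Injective ∧ g.Injective ∧
      ∀ i, I.rel Q (f i) (g i) := by
  obtain ⟨⟨A, B, hc, hm⟩, f, g, hf, hg, hfg⟩ := I.cutRel_cover_matching Q
  refine ⟨⟨A.map (labelEquiv n).symm.toEmbedding, B.map (labelEquiv n).symm.toEmbedding, ?_, ?_⟩,
    (labelEquiv n).symm ∘ f, (labelEquiv n).symm ∘ g, (labelEquiv n).symm.injective.comp hf,
    (labelEquiv n).symm.injective.comp hg, ?_⟩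
  · intro a b hab
    simpa [Finset.mem_map_equiv] using hc _ _ hab
  · simpa using hm
  · intro i
    simpa [rel] using hfg i

/-- This holds for all coin outcomes, so the only bad event is a drop in rank. -/
theorem rank_relMatrix_le (d : ℕ) [Fact (modulus d n).Prime] (l : List Bool) (Q : Query k) :
    (I.relMatrix d l Q).rank ≤ 3 * n ^ 2 + I.answer Q := by
  obtain ⟨⟨A, B, hc, hm⟩, -⟩ := I.rel_matching Q
  rw [← hm]
  refine Matrix.rank_le_of_cover _ A B fun a b hab => hc a b ?_
  by_contra h
  exact hab (by simp [relMatrix, h])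

/-- The row and the column at which the queried pair with number `b` is inserted. -/
def queryPosition (c : Fin 4) (b : Fin (k * k)) : Fin (4 * (n * n)) :=
  (labelEquiv n).symm (c, I.terminal b.divNat, I.terminal b.modNat)

theorem queryPosition_injective (c : Fin 4) : Function.Injective (I.queryPosition c) := by
  intro b b' h
  have h := (labelEquiv n).symm.injective h
  simp only [Prod.mk.injEq, EmbeddingLike.apply_eq_iff_eq, true_and] at h
  exact finProdFinEquiv.symm.injective (Prod.ext h.1 h.2)

theorem queryRel_terminal (Q : Query k) (i j : Fin k) :
    I.queryRel Q (I.terminal i) (I.terminal j) ↔ Q i j = true := by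
  constructor
  · rintro ⟨i', j', h, h1, h2⟩
    rwa [I.terminal.injective h1, I.terminal.injective h2] at h
  · exact fun h => ⟨i, j, h, rfl, rfl⟩

theorem rel_iff (Q : Query k) (i j : Fin (4 * (n * n))) :
    I.rel Q i j ↔ I.rel (fun _ _ => false) i j ∨
      ∃ b : Fin (k * k), Q b.divNat b.modNat = true ∧ I.queryPosition 1 b = i ∧
        I.queryPosition 2 b = j := by
  have h0 : ∀ u v, ¬ I.queryRel (fun _ _ => false) u v := by
    rintro u v ⟨_, _, h, -⟩
    simp at h
  have hlast : (((labelEquiv n i).1 : ℕ) = 1 ∧ ((labelEquiv n j).1 : ℕ) = 2 ∧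
      (labelEquiv n i).2 = (labelEquiv n j).2 ∧
        I.queryRel Q (labelEquiv n i).2.1 (labelEquiv n i).2.2) ↔
      ∃ b : Fin (k * k), Q b.divNat b.modNat = true ∧ I.queryPosition 1 b = i ∧
        I.queryPosition 2 b = j := by
    constructor
    · rintro ⟨h1, h2, h3, x, y, hQ, hx, hy⟩
      have hb := finProdFinEquiv.symm_apply_apply (x, y)
      set b := finProdFinEquiv (x, y)
      have e1 : b.divNat = x := congr_arg Prod.fst hb
      have e2 : b.modNat = y := congr_arg Prod.snd hb
      refine ⟨b, by rw [e1, e2, hQ], ?_, ?_⟩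
      · rw [queryPosition, Equiv.symm_apply_eq, e1, e2, hx, hy]
        exact Prod.ext (Fin.ext h1.symm) rfl
      · rw [queryPosition, Equiv.symm_apply_eq, e1, e2, hx, hy]
        exact Prod.ext (Fin.ext h2.symm) h3
    · rintro ⟨b, hQ, rfl, rfl⟩
      simp only [queryPosition, Equiv.apply_symm_apply]
      exact ⟨rfl, rfl, trivial, (I.queryRel_terminal Q _ _).2 hQ⟩
  rw [← hlast, rel, rel, cutRel, cutRel]
  simp only [h0, and_false, or_false, or_assoc]

theorem not_rel_queryPosition (b : Fin (k * k)) :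
    ¬ I.rel (fun _ _ => false) (I.queryPosition 1 b) (I.queryPosition 2 b) := by
  simp [rel, cutRel, queryPosition, queryRel]

/-- The form needed for `exists_small_matrix_nullity`: the weights depend on the position alone, and
the query enters only through 0/1 switches at positions that are empty in the base matrix. -/
theorem relMatrix_eq_add (d : ℕ) (l : List Bool) (Q : Query k) :
    I.relMatrix d l Q = I.relMatrix d l (fun _ _ => false) +
      ∑ b : Fin (k * k), Matrix.single (I.queryPosition 1 b) (I.queryPosition 2 b)
        ((if Q b.divNat b.modNat = true then 1 else 0) *
          weights n d l (finProdFinEquiv (I.queryPosition 1 b, I.queryPosition 2 b))) := by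
  classical
  ext i j
  rw [Matrix.add_apply, Matrix.sum_apply]
  by_cases h : ∃ b : Fin (k * k), I.queryPosition 1 b = i ∧ I.queryPosition 2 b = j
  · obtain ⟨b, rfl, rfl⟩ := h
    rw [Finset.sum_eq_single b]
    · have h1 : I.rel Q (I.queryPosition 1 b) (I.queryPosition 2 b) ↔
          Q b.divNat b.modNat = true := by
        rw [rel_iff]
        constructor
        · rintro (h | ⟨b', h, h', -⟩)
          · exact absurd h (I.not_rel_queryPosition b)
          · rwa [I.queryPosition_injective 1 h'] at h
        · exact fun h => Or.inr ⟨b, h, rfl, rfl⟩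
      simp only [relMatrix, Matrix.of_apply, h1, I.not_rel_queryPosition b, if_false, zero_add,
        Matrix.single_apply_same, ite_mul, one_mul, zero_mul]
    · intro b' _ hb'
      have hne : I.queryPosition 1 b' ≠ I.queryPosition 1 b :=
        fun h => hb' (I.queryPosition_injective 1 h)
      exact Matrix.single_apply_of_row_ne hne ..
    · simp
  · rw [Finset.sum_eq_zero, add_zero]
    · have : I.rel Q i j ↔ I.rel (fun _ _ => false) i j := by
        rw [rel_iff]
        constructor
        · rintro (h' | ⟨b, -, h'⟩)
          · exact h'
          · exact absurd ⟨b, h'⟩ h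
        · exact Or.inl
      simp only [relMatrix, Matrix.of_apply, this]
    · intro b _
      exact Matrix.single_apply_of_ne (h := fun h' => h ⟨b, h'⟩) ..

end STInstance

/-! ### Packing the compressed data into digits -/

theorem exists_digits (p D : ℕ) (hp : 0 < p) (g : ℕ → ℕ) :
    ∃ X < p ^ D, ∀ m < D, X / p ^ m % p = g m % p := by
  refine ⟨finFunctionFinEquiv fun i : Fin D => (⟨g i % p, Nat.mod_lt _ hp⟩ : Fin p), Fin.isLt _,
    fun m hm => ?_⟩
  have := congr_fun (finFunctionFinEquiv.symm_apply_apply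
    fun i : Fin D => (⟨g i % p, Nat.mod_lt _ hp⟩ : Fin p)) ⟨m, hm⟩
  exact congr_arg Fin.val this

theorem sum_digits_eq (n X L : ℕ) (h : X < n ^ L) :
    ∑ i ∈ Finset.range L, X / n ^ i % n * n ^ i = X := by
  have : ∀ L, ∑ i ∈ Finset.range L, X / n ^ i % n * n ^ i = X % n ^ L := by
    intro L
    induction L with
    | zero => simp [Nat.mod_one]
    | succ L ih => rw [Finset.sum_range_succ, ih, Nat.mod_pow_succ, mul_comm]
  rw [this, Nat.mod_eq_of_lt h]

/-- Layout: digit 0 is κ, the next 2K² digits list `E` row by row, and the 2K² after these list `H`.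
-/
theorem exists_digits_matrices {p K D : ℕ} [NeZero p] (hD : 1 + 4 * K * K ≤ D) (κ : ℕ) (hκ : κ < p)
    (E H : Matrix (Fin (2 * K)) (Fin K) (ZMod p)) :
    ∃ X < p ^ D, X % p = κ ∧ ∀ (i : Fin (2 * K)) (j : Fin K),
      ((X / p ^ (1 + (j + K * i : ℕ)) % p : ℕ) : ZMod p) = E i j ∧
      ((X / p ^ (1 + 2 * K * K + (j + K * i : ℕ)) % p : ℕ) : ZMod p) = H i j := by
  classical
  let e : Fin (2 * K) × Fin K ≃ Fin (2 * K * K) := finProdFinEquiv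
  let val (E : Matrix (Fin (2 * K)) (Fin K) (ZMod p)) (m : ℕ) : ℕ :=
    if h : m < 2 * K * K then (E (e.symm ⟨m, h⟩).1 (e.symm ⟨m, h⟩).2).val else 0
  have hlt : ∀ (i : Fin (2 * K)) (j : Fin K), (j + K * i : ℕ) < 2 * K * K := fun i j =>
    (e (i, j)).2
  have hval : ∀ E (i : Fin (2 * K)) (j : Fin K), val E (j + K * i) = (E i j).val := by
    intro E i j
    simp only [val]
    rw [dif_pos (hlt i j)]
    have : e.symm ⟨(j + K * i : ℕ), hlt i j⟩ = (i, j) := by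
      rw [Equiv.symm_apply_eq]
      exact Fin.ext rfl
    rw [this]
  obtain ⟨X, hX, hd⟩ := exists_digits p D (NeZero.pos p) fun m =>
    if m = 0 then κ else if m < 1 + 2 * K * K then val E (m - 1) else val H (m - (1 + 2 * K * K))
  have h4 : 4 * K * K = 2 * K * K + 2 * K * K := by ring
  refine ⟨X, hX, ?_, fun i j => ⟨?_, ?_⟩⟩
  · have := hd 0 (by omega)
    simpa [Nat.mod_eq_of_lt hκ] using this
  · have := hlt i j
    rw [hd _ (by omega), if_neg (by omega), if_pos (by omega), Nat.add_sub_cancel_left, hval,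
      ZMod.natCast_mod, ZMod.natCast_zmod_val]
  · have := hlt i j
    rw [hd _ (by omega), if_neg (by omega), if_neg (by omega), Nat.add_sub_cancel_left, hval,
      ZMod.natCast_mod, ZMod.natCast_zmod_val]

/-! ### Existence of a sketch and correct decoding -/

namespace STInstance

variable {k n : ℕ} (I : STInstance k n)

/-- Ensures that κ, which is at most the number of columns, fits into one base-p digit. -/
theorem card_lt_modulus {n : ℕ} (hn : 2 ≤ n) (d : ℕ) : 4 * (n * n) < modulus d n := by
  refine lt_of_le_of_lt ?_ (modulus_spec d n).2.1
  rw [two_pow_weightBits]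
  have h1 := (le_two_pow_ceilLog hn).1
  have h2 : 1 ≤ 2 ^ d := Nat.one_le_two_pow
  calc 4 * (n * n) = 4 * 1 * n ^ 2 := by ring
    _ ≤ 4 * 2 ^ d * (2 ^ ceilLog n) ^ 2 := by gcongr

/-- Nullity compression holds for any weights, so the search succeeds for every coin outcome, even
when ranks have dropped. -/
theorem exists_isSketchNumber (d : ℕ) (l : List Bool) :
    ∃ X < modulus d n ^ sketchDigits k, IsSketchNumber k d I.encoding l X := by
  have hp := (modulus_spec d n).1
  have : Fact (modulus d n).Prime := ⟨hp⟩
  obtain ⟨κ, hκ, E, H, h⟩ := exists_small_matrix_nullity (ι := Fin (2 * (k * k)))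
    (by simp) (I.relMatrix d l fun _ _ => false) (I.queryPosition 1) (I.queryPosition 2)
    (fun b => weights n d l (finProdFinEquiv (I.queryPosition 1 b, I.queryPosition 2 b)))
  rw [Fintype.card_fin] at hκ
  obtain ⟨X, hX, h0, hd⟩ := exists_digits_matrices (D := sketchDigits k) (K := k * k)
    (by rw [sketchDigits]) κ (hκ.trans_lt (card_lt_modulus I.two_le d)) E H
  refine ⟨X, hX, fun Q _ => ?_⟩
  rw [size_encoding, kerCount_eq_pow, kerCount_eq_pow, h0, ← pow_add, cutMatrix_eq,
    relMatrix_eq_add, h fun b => if Q b.divNat b.modNat = true then 1 else 0]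
  suffices h : E + H * Matrix.diagonal (fun b : Fin (k * k) =>
      if Q b.divNat b.modNat = true then (1 : ZMod (modulus d n)) else 0) =
      Matrix.of fun (i : Fin (2 * (k * k))) (j : Fin (k * k)) =>
        (smallMatrix (modulus d n) X Q i j : ZMod (modulus d n)) by rw [h]
  ext i j
  rw [Matrix.add_apply, Matrix.mul_diagonal, Matrix.of_apply, smallMatrix, Nat.cast_add,
    Nat.cast_mul, (hd i j).1, (hd i j).2, ← Fin.coe_divNat, ← Fin.coe_modNat, Query.bit_val]
  push_cast
  rfl

theorem answerFromNumber_eq (d : ℕ) (l : List Bool) {X : ℕ}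
    (hX : IsSketchNumber k d I.encoding l X) (Q : Query k)
    (hrank : (I.relMatrix d l Q).rank = 3 * n ^ 2 + I.answer Q) :
    answerFromNumber d n X Q = I.answer Q := by
  have hp := (modulus_spec d n).1
  have : Fact (modulus d n).Prime := ⟨hp⟩
  have h := hX Q (by simp)
  rw [size_encoding, kerCount_eq_pow, cutMatrix_eq, kerCount_eq_pow, ← pow_add] at h
  have h := Nat.pow_right_injective hp.two_le h
  have h1 := LinearMap.finrank_range_add_finrank_ker (I.relMatrix d l Q).mulVecLin
  have h2 : Module.finrank (ZMod (modulus d n)) (LinearMap.range (I.relMatrix d l Q).mulVecLin) =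
    3 * n ^ 2 + I.answer Q := hrank
  rw [h2, h, Module.finrank_fin_fun] at h1
  rw [answerFromNumber, kerCount_eq_pow]
  set ν := Module.finrank (ZMod (modulus d n)) (LinearMap.ker (Matrix.of
    fun (i : Fin (2 * (k * k))) (j : Fin (k * k)) =>
      (smallMatrix (modulus d n) X Q i j : ZMod (modulus d n))).mulVecLin)
  have hν : ν ≤ k * k := (Submodule.finrank_le _).trans (by simp)
  have hsum : (∑ r ∈ Finset.range (k * k),
      if modulus d n ^ (r + 1) ≤ modulus d n ^ ν then 1 else 0) = ν := by
    simp only [Nat.pow_le_pow_iff_right hp.one_lt, Nat.succ_le_iff]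
    rw [← Finset.card_filter]
    have : (Finset.range (k * k)).filter (fun r => r < ν) = Finset.range ν := by
      ext r
      simp only [Finset.mem_filter, Finset.mem_range]
      omega
    rw [this, Finset.card_range]
  rw [hsum]
  rw [sq] at h1
  omega

theorem sketchNumber_spec (d : ℕ) (l : List Bool) :
    sketchNumber k d I.encoding l < modulus d n ^ sketchDigits k ∧
      IsSketchNumber k d I.encoding l (sketchNumber k d I.encoding l) := by
  have := I.exists_isSketchNumber d l
  rw [sketchNumber, size_encoding]
  exact boundedSearch_spec this

theorem decodeSketch_sketch (d : ℕ) (l : List Bool) :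
    decodeSketch k d (sketch k d I.encoding l) = sketchNumber k d I.encoding l := by
  have hlt : sketchNumber k d I.encoding l < n ^ ((7 + d) * sketchDigits k) := by
    refine (I.sketchNumber_spec d l).1.trans_le ?_
    rw [pow_mul]
    exact Nat.pow_le_pow_left (modulus_le_pow d I.two_le) _
  rw [decodeSketch]
  conv_rhs => rw [← sum_digits_eq n _ _ hlt]
  refine Finset.sum_congr rfl fun i hi => ?_
  rw [Finset.mem_range] at hi
  simp [sketch, size_encoding, hi]

theorem answerFromSketch_eq (d : ℕ) (l : List Bool) (Q : Query k)
    (hrank : (I.relMatrix d l Q).rank = 3 * n ^ 2 + I.answer Q) :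
    answerFromSketch d (Q, sketch k d I.encoding l) = I.answer Q := by
  rw [answerFromSketch, decodeSketch_sketch]
  have : (sketch k d I.encoding l).getD 0 0 = n := by simp [sketch, size_encoding]
  rw [this]
  exact I.answerFromNumber_eq d l (I.sketchNumber_spec d l).2 Q hrank

end STInstance

/-! ### Coins, weights and the failure probability -/

theorem weight_ofFn {M b : ℕ} (r : Fin (M * b) → Bool) (m : Fin M) :
    weight b (List.ofFn r) m =
      finFunctionFinEquiv fun t : Fin b => finTwoEquiv.symm (r (finProdFinEquiv (m, t))) := by
  rw [weight, Finset.sum_range, finFunctionFinEquiv_apply]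
  refine Finset.sum_congr rfl fun t _ => ?_
  have h : (List.ofFn r).getD (t + b * m : ℕ) false = r (finProdFinEquiv (m, t)) :=
    List.getD_ofFn r (finProdFinEquiv (m, t)) false
  rw [h]
  cases r (finProdFinEquiv (m, t)) <;> rfl

theorem weight_ofFn_lt {M b : ℕ} (r : Fin (M * b) → Bool) (m : Fin M) :
    weight b (List.ofFn r) m < 2 ^ b := by
  rw [weight_ofFn]
  exact Fin.isLt _

theorem weight_ofFn_injective {M b : ℕ} {r r' : Fin (M * b) → Bool}
    (h : ∀ m : Fin M, weight b (List.ofFn r) m = weight b (List.ofFn r') m) : r = r' := by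
  ext x
  obtain ⟨⟨m, t⟩, rfl⟩ := finProdFinEquiv.surjective x
  have := h m
  rw [weight_ofFn, weight_ofFn] at this
  have := congr_fun (finFunctionFinEquiv.injective (Fin.ext this)) t
  rw [finTwoEquiv.symm.injective this]

theorem PMF.toReal_map_uniformOfFintype {α β : Type*} [Fintype α] [Nonempty α] [DecidableEq β]
    (f : α → β) (y : β) : (((PMF.uniformOfFintype α).map f) y).toReal =
      ((Finset.univ.filter fun x => f x = y).card : ℝ) / Fintype.card α := by
  classical
  rw [PMF.map_apply, tsum_fintype]
  simp only [PMF.uniformOfFintype_apply]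
  rw [← Finset.sum_filter, Finset.sum_const, nsmul_eq_mul, ENNReal.toReal_mul, ENNReal.toReal_inv,
    ENNReal.toReal_natCast, ENNReal.toReal_natCast, div_eq_mul_inv]
  congr 4
  ext x
  simp [eq_comm]

namespace STInstance

variable {k n : ℕ} (I : STInstance k n)

theorem coinCount_encoding (d : ℕ) :
    coinCount d I.encoding = 4 * (n * n) * (4 * (n * n)) * weightBits d n := by
  rw [coinCount, size_encoding]

/-- Weights below 2^b stay distinct modulo p > 2^b, so coin outcomes inject into weight vectors over
a set of 2^b residues. Schwartz-Zippel bounds the bad fraction by 4n² / 2^b, which is at most 2^(-d)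
by the choice of `weightBits`. -/
theorem card_bad_coins_le (d : ℕ) (Q : Query k) :
    (Finset.univ.filter fun r : Fin (4 * (n * n) * (4 * (n * n)) * weightBits d n) → Bool =>
      (I.relMatrix d (List.ofFn r) Q).rank ≠ 3 * n ^ 2 + I.answer Q).card * 2 ^ d ≤
      2 ^ (4 * (n * n) * (4 * (n * n)) * weightBits d n) := by
  classical
  have hp := (modulus_spec d n).1
  have : Fact (modulus d n).Prime := ⟨hp⟩
  obtain ⟨-, f, g, hf, hg, hfg⟩ := I.rel_matching Q
  set b := weightBits d n with hb
  set p := modulus d n with hpdef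
  set S : Finset (ZMod p) := (Finset.range (2 ^ b)).image fun x : ℕ => (x : ZMod p) with hS
  have hcast : ∀ x y : ℕ, x < 2 ^ b → y < 2 ^ b → (x : ZMod p) = y → x = y := by
    intro x y hx hy h
    have hlt := (modulus_spec d n).2.1
    have := (ZMod.natCast_eq_natCast_iff' _ _ _).1 h
    rwa [Nat.mod_eq_of_lt (hx.trans hlt), Nat.mod_eq_of_lt (hy.trans hlt)] at this
  have hScard : S.card = 2 ^ b := by
    rw [hS, Finset.card_image_of_injOn, Finset.card_range]
    intro x hx y hy h
    exact hcast x y (by simpa using hx) (by simpa using hy) h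
  have hsz := card_rank_lt_le (I.rel Q) finProdFinEquiv.toEmbedding f g hf hg hfg S
  rw [hScard] at hsz
  set bad := Finset.univ.filter fun r : Fin (4 * (n * n) * (4 * (n * n)) * b) → Bool =>
      (I.relMatrix d (List.ofFn r) Q).rank ≠ 3 * n ^ 2 + I.answer Q with hbad
  have hle : bad.card ≤ ((Fintype.piFinset fun _ : Fin (4 * (n * n) * (4 * (n * n))) => S).filter
      fun w => (Matrix.of fun a c => if I.rel Q a c then
        w (finProdFinEquiv.toEmbedding (a, c)) else 0).rank < 3 * n ^ 2 + I.answer Q).card := by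
    refine Finset.card_le_card_of_injOn (fun r => weights n d (List.ofFn r)) ?_ ?_
    · intro r hr
      have hr := (Finset.mem_filter.1 (Finset.mem_coe.1 hr)).2
      have hlt := lt_of_le_of_ne (I.rank_relMatrix_le d (List.ofFn r) Q) hr
      refine Finset.mem_coe.2 (Finset.mem_filter.2 ⟨?_, ?_⟩)
      · rw [Fintype.mem_piFinset]
        intro m
        exact Finset.mem_image_of_mem _ (Finset.mem_range.2 (weight_ofFn_lt r m))
      · refine lt_of_eq_of_lt (congr_arg Matrix.rank ?_) hlt
        ext a c
        simp only [relMatrix, Matrix.of_apply]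
        split_ifs <;> rfl
    · intro r _ r' _ h
      refine weight_ofFn_injective fun m => ?_
      exact hcast _ _ (weight_ofFn_lt r m) (weight_ofFn_lt r' m) (congr_fun h m)
  have hrank : 3 * n ^ 2 + I.answer Q ≤ 4 * (n * n) := by
    simpa using Fintype.card_le_of_injective f hf
  have hbits : 4 * (n * n) * 2 ^ d ≤ 2 ^ b := by
    rw [hb, two_pow_weightBits]
    have h1 := (le_two_pow_ceilLog I.two_le).1
    calc 4 * (n * n) * 2 ^ d = 4 * 2 ^ d * n ^ 2 := by ring
      _ ≤ 4 * 2 ^ d * (2 ^ ceilLog n) ^ 2 := by gcongr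
  have hpos : 0 < 4 * (n * n) := by have := I.two_le; positivity
  have h1 : bad.card * 2 ^ b ≤ 4 * (n * n) * (2 ^ b) ^ (4 * (n * n) * (4 * (n * n))) :=
    (Nat.mul_le_mul_right _ hle).trans (hsz.trans (Nat.mul_le_mul_right _ hrank))
  rw [← pow_mul, mul_comm b] at h1
  refine Nat.le_of_mul_le_mul_left ?_ hpos
  calc 4 * (n * n) * (bad.card * 2 ^ d) = bad.card * (4 * (n * n) * 2 ^ d) := by ring
    _ ≤ bad.card * 2 ^ b := Nat.mul_le_mul_left _ hbits
    _ ≤ _ := h1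

/-- Extraction tosses no coins, so only those of the compression matter. -/
theorem output_sketchingScheme (d : ℕ) (Q : Query k) :
    (sketchingScheme k d).output I Q =
      (PMF.uniformOfFintype (Fin (coinCount d I.encoding) → Bool)).map fun r =>
        answerFromSketch d (Q, sketch k d I.encoding (List.ofFn r)) := by
  have h : ∀ Γ, (sketchingScheme k d).extract.dist (Q, Γ) =
      PMF.pure (answerFromSketch d (Q, Γ)) := fun Γ => PMF.map_const _ _
  rw [STSketchingScheme.output]
  simp only [h]
  rw [RandAlg.dist, PMF.bind_map, PMF.map]
  rfl

end STInstance

/-! ### Correctness, sketch size and choice of constants -/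

theorem sketchingScheme_correct (k d : ℕ) :
    (sketchingScheme k d).CorrectWithProb (1 - 1 / 2 ^ d) := by
  classical
  intro n I Q
  rw [I.output_sketchingScheme, PMF.toReal_map_uniformOfFintype, I.coinCount_encoding]
  have hbad := I.card_bad_coins_le d Q
  set c := 4 * (n * n) * (4 * (n * n)) * weightBits d n
  have hsplit := Finset.card_filter_add_card_filter_not (s := (Finset.univ : Finset (Fin c → Bool)))
    fun r => (I.relMatrix d (List.ofFn r) Q).rank = 3 * n ^ 2 + I.answer Q
  have hgood : (Finset.univ.filter fun r : Fin c → Bool =>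
      (I.relMatrix d (List.ofFn r) Q).rank = 3 * n ^ 2 + I.answer Q).card ≤
      (Finset.univ.filter fun r : Fin c → Bool =>
        answerFromSketch d (Q, sketch k d I.encoding (List.ofFn r)) = I.answer Q).card :=
    Finset.card_le_card (Finset.monotone_filter_right _ fun r _ hr =>
      I.answerFromSketch_eq d (List.ofFn r) Q hr)
  have hcard : Fintype.card (Fin c → Bool) = 2 ^ c := by simp
  rw [Finset.card_univ, hcard] at hsplit
  rw [hcard]
  set good := (Finset.univ.filter fun r : Fin c → Bool =>
    (I.relMatrix d (List.ofFn r) Q).rank = 3 * n ^ 2 + I.answer Q).card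
  set bad := (Finset.univ.filter fun r : Fin c → Bool =>
    (I.relMatrix d (List.ofFn r) Q).rank ≠ 3 * n ^ 2 + I.answer Q).card
  set correct := (Finset.univ.filter fun r : Fin c → Bool =>
        answerFromSketch d (Q, sketch k d I.encoding (List.ofFn r)) = I.answer Q).card
  have hbad' : (bad : ℝ) * 2 ^ d ≤ 2 ^ c := by exact_mod_cast hbad
  have hsplit' : (good : ℝ) + bad = 2 ^ c := by exact_mod_cast hsplit
  have hgood' : (good : ℝ) ≤ correct := by exact_mod_cast hgood
  have hb : (bad : ℝ) ≤ 2 ^ c / 2 ^ d := by rwa [le_div_iff₀ (by positivity)]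
  push_cast
  rw [le_div_iff₀ (by positivity)]
  have : (1 - 1 / 2 ^ d : ℝ) * 2 ^ c = 2 ^ c - 2 ^ c / 2 ^ d := by ring
  rw [this]
  linarith

theorem sketchingScheme_size {k n : ℕ} (d : ℕ) (I : STInstance k n) {Γ : List ℕ}
    (hΓ : Γ ∈ ((sketchingScheme k d).compress.dist I.encoding).support) :
    Γ.length = (7 + d) * sketchDigits k + 1 ∧ ∀ w ∈ Γ, w < n ^ 2 := by
  rw [RandAlg.dist, PMF.support_map] at hΓ
  obtain ⟨r, -, rfl⟩ := hΓ
  have hn := I.two_le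
  -- The first word is n itself, so the word bound has to exceed n.
  have hn2 : n < n ^ 2 := by nlinarith
  refine ⟨by simp [sketchingScheme, sketch], fun w hw => ?_⟩
  simp only [sketchingScheme, sketch, I.size_encoding, List.mem_cons, List.mem_map] at hw
  rcases hw with rfl | ⟨i, -, rfl⟩
  · exact hn2
  · exact (Nat.mod_lt _ (by omega)).trans hn2

theorem exists_sketchingScheme : ∃ C : ℕ, ∀ (k : ℕ) (δ : ℝ), 1 ≤ k → 0 < δ →
    ∃ S : STSketchingScheme k, S.CorrectWithProb (1 - δ) ∧
      S.SketchSizeAtMost C (C * (k : ℝ) ^ 4 * max 1 (Real.log (1 / δ))) := by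
  -- The size is at most 10μ · 5k⁴ + 1, and the 1 is absorbed since k, μ ≥ 1.
  refine ⟨51, fun k δ hk hδ => ?_⟩
  set μ := max 1 (Real.log (1 / δ)) with hμ
  -- The logarithm is natural; the factor 2 suffices for 2^(-d) ≤ δ because 2 log 2 > 1.
  set d := ⌈2 * μ⌉₊ with hd
  have hμ1 : 1 ≤ μ := le_max_left _ _
  have hδd : 1 / 2 ^ d ≤ δ := by
    have h1 : Real.log (1 / δ) ≤ d * Real.log 2 := by
      have := Real.log_two_gt_d9
      have h2 : 2 * μ ≤ d := Nat.le_ceil _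
      have h3 : Real.log (1 / δ) ≤ μ := le_max_right _ _
      nlinarith
    rw [← Real.log_pow, Real.log_le_log_iff (by positivity) (by positivity)] at h1
    rwa [one_div_le (by positivity) hδ]
  refine ⟨sketchingScheme k d, fun n I Q => ?_, fun n I Γ hΓ => ?_⟩
  · exact (by linarith : 1 - δ ≤ 1 - 1 / 2 ^ d).trans (sketchingScheme_correct k d n I Q)
  · obtain ⟨h1, h2⟩ := sketchingScheme_size d I hΓ
    refine ⟨?_, fun w hw => (h2 w hw).trans_le (Nat.pow_le_pow_right (by have := I.two_le; omega)
      (by norm_num))⟩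
    rw [h1, sketchDigits]
    have hk1 : (1 : ℝ) ≤ (k : ℝ) ^ 4 := one_le_pow₀ (by exact_mod_cast hk)
    have hd1 : (d : ℝ) ≤ 2 * μ + 1 := (Nat.ceil_lt_add_one (by positivity)).le
    push_cast
    have e1 : (1 + 4 * ((k : ℝ) * k) * (k * k)) ≤ 5 * (k : ℝ) ^ 4 := by nlinarith
    have e2 : (7 + (d : ℝ)) ≤ 10 * μ := by linarith
    calc (7 + (d : ℝ)) * (1 + 4 * ((k : ℝ) * k) * (k * k)) + 1
        ≤ 10 * μ * (5 * (k : ℝ) ^ 4) + 1 := by gcongr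
      _ ≤ 51 * (k : ℝ) ^ 4 * μ := by nlinarith

theorem mainTheorem5 :
    (∃ C : ℕ, ∀ (k : ℕ) (δ : ℝ), 1 ≤ k → 0 < δ →
      ∃ S : STSketchingScheme k,
        S.CorrectWithProb (1 - δ) ∧
        S.SketchSizeAtMost C (C * (k : ℝ) ^ 4 * max 1 (Real.log (1 / δ)))) ∧
    (∃ C : ℕ, ∀ k : ℕ, ∃ matchingQuery : Query k → SimpleGraph (Fin (4 * k ^ 2)),
      ∀ (n : ℕ) (I : STInstance k n),
        ∃ (N : ℕ) (G' : SimpleGraph (Fin N)) (terminal' : Fin (4 * k ^ 2) ↪ Fin N)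
          (side : Fin N → Bool) (m : ℕ),
          N ≤ C * n ^ 2 ∧
          ∀ Q : Query k,
            (∀ u v, (G' ⊔ (matchingQuery Q).map terminal').Adj u v → side u ≠ side v) ∧
            matchingNumber (G' ⊔ (matchingQuery Q).map terminal') + Q.size =
              I.answer Q + (m + 2 * k ^ 2)) :=
  ⟨exists_sketchingScheme, exists_matching_reduction⟩
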